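/- **Setting.** Let $M$ be a compact (connected) smooth Riemannian manifold of dimension $d$ with Riemannian distance $d(\cdot,\cdot)$ and volume $\mathrm{Vol}$, and let $f:M\to M$ be $C^2$ off its singular set $\mathcal S=\{x: f \text{ is not differentiable at } x\}$. Let $\mathcal C=\{x\notin\mathcal S:\ker Df(x)\neq 0\}$ be its critical set and write $Jf=|\det Df|$ for the Jacobian with respect to the Riemannian metric. Assume that the critical and singular points are non-degenerate: there are $\beta,A,k>0$ such that * if $\mathcal C\ne\emptyset$, then $0<\sup_{x\in V\setminus(\mathcal C\cup\mathcal S)}\|Df(x)^{-1}\|^{-1}/d(x,\mathcal C)^{\beta}<\infty$ for some open $V\supset\mathcal C$; * if $\mathcal S\neq\emptyset$, then $0<\sup_{x\in W\setminus\mathcal S}\|Df(x)\|/d(x,\mathcal S)^{-\beta}<\infty$ for some open $W\supset\mathcal S$; * $|\log Jf(x)-\log Jf(y)|\le A\,d(x,y)/d(x,\mathcal C\cup\mathcal S)^{k}$ for all $x,y\notin\mathcal C\cup\mathcal S$ with $d(x,y)\le d(x,\mathcal C\cup\mathcal S)/2$. Let $\mu$ be an ergodic $f$-invariant Borel probability with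 $\mu\ll\mathrm{Vol}$ which is expanding (for $\mu$-a.e. $x$ the limit $\lim_n\frac1n\log\|Df^n(x)v\|$ exists and is positive for all $v\in T_xM\setminus\{0\}$) and regular ($\mu(\mathcal C\cup\mathcal S)=0$ and $\int\max\{\log\|Df\|,\log\|Df^{-1}\|\}\,d\mu<\infty$). Let $\chi>0$ be its least Lyapunov exponent. Let $Z=\{(z_n)_{n\ge0}: f(z_{n+1})=z_n\}\subset M^{\mathbb N}$, $F(z_0,z_1,\dots)=(f(z_0),z_0,z_1,\dots)$ and $\pi(z)=z_0$, and let $\bar\mu$ be the lift of $\mu$ to $Z$, that is, the measure all of whose coordinate marginals are $\mu$. **Rectangles.** An open disc is an open subset of $M$ that is $C^2$ diffeomorphic to an open ball $B(x,r)\subset M$. A rectangle with base $B$ (an open disc) is a set $S\subset Z$ with a homeomorphism $\Phi:S\to B\times K$, where $K=S\cap\pi^{-1}(x_0)$ for some $x_0\in B$, such that the first component of $\Phi$ is $\pi$, $\Phi(w)=(x_0,w)$ for $w\in K$, and $\pi$ maps every plaque $\Phi^{-1}(B\times\{k\})$ diffeomorphically onto $B$ (the inverse $B\to Z\subset M^{\mathbb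 N}$ is $C^2$ in each coordinate). The plaque of $S$ through $z\in S$ is denoted by $S_z$. The height $K$ is required to be nonempty, totally disconnected, locally compact and without isolated points; thus $K$ is a Cantor set if it is compact, and a Cantor set minus one point otherwise. A subrectangle of a rectangle $\Sigma$ is a rectangle $S\subset\Sigma$ with $S_z=S\cap\Sigma_z$ for all $z\in S$; it is a $u$-rectangle of $\Sigma$ if $\Sigma_z\subset S$ for all $z\in S$. A map $F^n:S\to U$ between rectangles is a laminated diffeomorphism if it is a homeomorphism of $S$ onto $U$ that maps plaques onto plaques and if, in the parametrizations of the plaques by $\pi$, it is a $C^2$ diffeomorphism $f^n$ of the base of $S$ onto the base of $U$. **Regular returns.** A rectangle $\Sigma$ with base $B$ has regular returns with constant $C>0$ if for all $z,z'\in\Sigma$ and $n,m>0$: the sets $F^{-n}\Sigma_z$ and $F^{-m}\Sigma_{z'}$ are disjoint or nested, and so are their images under $\pi$; $\pi$ maps $F^{-n}\Sigma_z$ diffeomorphically onto $\pi F^{-n}\Sigma_z$; $f^n:\pi F^{-n}\Sigma_z\to B$ is a $C^2$ diffeomorphism; and for all $w,w'\in F^{-n}\Sigma_z$, $v\in T_{\pi(w)}M$,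 $$\|Df^n(\pi(w))v\|\ge C^{-1}e^{n\chi/2}\|v\|,\qquad \frac{Jf^n(\pi(w))}{Jf^n(\pi(w'))}\le e^{C\,d(f^n(\pi(w)),f^n(\pi(w')))},\qquad \prod_{i=0}^{\infty}\frac{Jf(\pi(F^{-i}w))}{Jf(\pi(F^{-i}w'))}\le e^{C\,d(\pi(w),\pi(w'))},$$ where the infinite product converges. **Statement.** Let $\Sigma$ be a rectangle whose height is a Cantor set, with regular returns with constant $C$, and with $\bar\mu(\Sigma)>0$. Let $\overline R(z)=\min\{n>0:F^n(z)\in\Sigma\}$ be the first return time and $\tau(z)=F^{\overline R(z)}(z)$ the first return map. Then there are a countable family of pairwise disjoint subrectangles $S_j$ of $\Sigma$, pairwise disjoint $u$-rectangles $U_j$ of $\Sigma$, and integers $\overline R_j>0$ such that 1. $\bar\mu(\Sigma\setminus\bigcup_jS_j)=\bar\mu(\Sigma\setminus\bigcup_jU_j)=0$; 2. for every $j$, $F^{\overline R_j}:S_j\to U_j$ is a laminated diffeomorphism, $\overline R=\overline R_j$ and $\tau=F^{\overline R_j}$ on $S_j$, and for all $z\in S_j$, all $w,w'\in S_j\cap\Sigma_z$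 and all $v\in T_{\pi(w)}M$, $$\|Df^{\overline R_j}(\pi(w))v\|\ge C^{-1}e^{\overline R_j\chi/3}\|v\|,\qquad \frac{Jf^{\overline R_j}(\pi(w))}{Jf^{\overline R_j}(\pi(w'))}\le\exp\bigl(C\,d(f^{\overline R_j}(\pi(w)),f^{\overline R_j}(\pi(w')))\bigr);$$ 3. for every $m>0$ there are only finitely many $j$ with $\overline R_j=m$. -/

import Mathlib

open MeasureTheory Set Filter Topology Manifold Bundle
open scoped ContDiff Bundle

noncomputable section

/-! ### The natural extension -/

section NaturalExtension

variable {M : Type*}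

/-- The phase space `Z` of the natural extension: the pre-orbits `(z₀, z₁, …)` of `f`, with
`f (zₙ₊₁) = zₙ`. Topology and `σ`-algebra are those inherited from the product `M^ℕ`. -/
abbrev PreOrbit (f : M → M) : Type _ := {z : ℕ → M // ∀ n, f (z (n + 1)) = z n}

/-- The projection `π` on the first coordinate. -/
def proj (f : M → M) (z : PreOrbit f) : M := z.1 0

/-- The map `F (z₀, z₁, …) = (f z₀, z₀, z₁, …)` with inverse `(z₀, z₁, …) ↦ (z₁, z₂, …)`. -/
def natExt (f : M → M) : PreOrbit f ≃ PreOrbit f where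
  toFun z := ⟨fun n => Nat.casesOn n (f (z.1 0)) z.1, fun n => by
    cases n with
    | zero => rfl
    | succ k => exact z.2 k⟩
  invFun z := ⟨fun n => z.1 (n + 1), fun n => z.2 (n + 1)⟩
  left_inv z := rfl
  right_inv z := by
    apply Subtype.ext
    funext n
    cases n with
    | zero => exact z.2 0
    | succ k => rfl

/-- The set `F⁻ⁿ P`. -/
def backImage (f : M → M) (n : ℕ) (P : Set (PreOrbit f)) : Set (PreOrbit f) :=
  (natExt f)^[n] ⁻¹' P

/-- `μbar` is the lift of `μ` to the natural extension: all its coordinate marginals are `μ`. (The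
first `n` coordinates of a pre-orbit are functions of the `n`-th one, so that there is at most one
such measure.) -/
def IsLift [MeasurableSpace M] (f : M → M) (μ : Measure M) (μbar : Measure (PreOrbit f)) : Prop :=
  ∀ n : ℕ, ∀ A : Set M, MeasurableSet A → μbar ((fun z : PreOrbit f => z.1 n) ⁻¹' A) = μ A

/-- The first return time to `S`, `min {n > 0 : Fⁿ z ∈ S}` (with value `0` if there is no
return). -/
def firstReturnTime (f : M → M) (S : Set (PreOrbit f)) (z : PreOrbit f) : ℕ :=
  sInf {n : ℕ | 0 < n ∧ (natExt f)^[n] z ∈ S}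

/-- The first return map `τ` to `S`. -/
def firstReturnMap (f : M → M) (S : Set (PreOrbit f)) (z : PreOrbit f) : PreOrbit f :=
  (natExt f)^[firstReturnTime f S z] z

/-- The part of `S ⊆ Z` in the vertical fibre `π⁻¹(x)`. -/
def crossSection (f : M → M) (S : Set (PreOrbit f)) (x : M) : Set (PreOrbit f) :=
  {w | w ∈ S ∧ proj f w = x}

/-- Two sets are disjoint or nested. -/
def DisjointOrNested {α : Type*} (A B : Set α) : Prop := Disjoint A B ∨ A ⊆ B ∨ B ⊆ A

end NaturalExtension

/-! ### Discs, plaques and rectangles -/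

section Rectangles

variable (d : ℕ) {M : Type*} [MetricSpace M] [ChartedSpace (EuclideanSpace ℝ (Fin d)) M]

/-- `g` restricts to a `C²` diffeomorphism of the open set `A` onto the open set `B`. -/
def IsDiffeoOn (g : M → M) (A B : Set M) : Prop :=
  IsOpen A ∧ IsOpen B ∧ ContMDiffOn (𝓡 d) (𝓡 d) 2 g A ∧
    ∃ h : M → M, ContMDiffOn (𝓡 d) (𝓡 d) 2 h B ∧
      MapsTo g A B ∧ MapsTo h B A ∧ InvOn h g A B

/-- An open disc: an open set which is diffeomorphic to an open ball of `M`. -/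
def IsOpenDisc (B : Set M) : Prop :=
  ∃ (x : M) (r : ℝ), 0 < r ∧ ∃ g : M → M, IsDiffeoOn d g B (Metric.ball x r)

/-- `π` restricts to a diffeomorphism of the plaque `P ⊆ Z` onto the open set `V ⊆ M`: it maps `P`
bijectively onto `V`, and the inverse `V → P ⊆ M^ℕ`, the parametrization of the plaque by a
sequence of inverse branches of the iterates of `f`, is `C²` in every coordinate. -/
def ProjIsDiffeo (f : M → M) (P : Set (PreOrbit f)) (V : Set M) : Prop :=
  IsOpen V ∧ BijOn (proj f) P V ∧
    ∀ n : ℕ, ∃ g : M → M, ContMDiffOn (𝓡 d) (𝓡 d) 2 g V ∧ ∀ w ∈ P, g (proj f w) = w.1 n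

/-- A (regular) rectangle. The height is the cross-section over a reference point `center` of the
base, and the chart is `Φ w = (π w, φ w)`, where `φ` is the holonomy along the plaques to the
cross-section over the reference point. The height is a nonempty, totally disconnected, locally
compact set without isolated points: if it is compact this says that it is a Cantor set, and
otherwise it is homeomorphic to a Cantor set without one point. -/
structure Rectangle (f : M → M) where
  carrier : Set (PreOrbit f)
  base : Set M
  isOpenDisc_base : IsOpenDisc d base
  center : M
  center_mem : center ∈ base
  nonempty_height : (crossSection f carrier center).Nonempty
  isTotallyDisconnected_height : IsTotallyDisconnected (crossSection f carrier center)
  preperfect_height : Preperfect (crossSection f carrier center)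
  locallyCompact_height : LocallyCompactSpace (crossSection f carrier center)
  chart : carrier ≃ₜ base × crossSection f carrier center
  chart_fst : ∀ w : carrier, ((chart w).1 : M) = proj f w
  chart_snd_center : ∀ w : crossSection f carrier center, (chart ⟨w.1, w.2.1⟩).2 = w
  projIsDiffeo_plaque : ∀ k : crossSection f carrier center,
    ProjIsDiffeo d f {w | ∃ hw : w ∈ carrier, (chart ⟨w, hw⟩).2 = k} base

namespace Rectangle

variable {d} {f : M → M}

/-- The height of a rectangle. -/
def height (S : Rectangle d f) : Set (PreOrbit f) := crossSection f S.carrier S.center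

/-- The plaque of `S` through the point `z` of `S`. -/
def plaque (S : Rectangle d f) (z : PreOrbit f) : Set (PreOrbit f) :=
  {w | ∃ (hw : w ∈ S.carrier) (hz : z ∈ S.carrier), (S.chart ⟨w, hw⟩).2 = (S.chart ⟨z, hz⟩).2}

/-- `S` is a subrectangle of `T`: a rectangle contained in `T` whose plaques are the intersections
of `S` with the plaques of `T`. -/
def IsSubrectangle (S T : Rectangle d f) : Prop :=
  S.carrier ⊆ T.carrier ∧ ∀ z ∈ S.carrier, S.plaque z = S.carrier ∩ T.plaque z

/-- `U` is a `u`-rectangle of `T`: a rectangle contained in `T` which contains the whole plaque of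
`T` through each of its points. -/
def IsURectangle (U T : Rectangle d f) : Prop :=
  U.IsSubrectangle T ∧ ∀ w ∈ U.carrier, U.carrier ∩ T.plaque w = T.plaque w

/-- `Fⁿ : S → U` is a laminated diffeomorphism: a homeomorphism which maps the plaques of `S` onto
plaques of `U`, diffeomorphically (in the parametrizations of the plaques by `π`, the restriction
of `Fⁿ` to a plaque is `fⁿ` from the base of `S` to the base of `U`). -/
def IsLaminatedDiffeo (n : ℕ) (S U : Rectangle d f) : Prop :=
  BijOn (natExt f)^[n] S.carrier U.carrier ∧
    ContinuousOn (natExt f)^[n] S.carrier ∧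
    ContinuousOn (natExt f).symm^[n] U.carrier ∧
    (∀ z ∈ S.carrier, (natExt f)^[n] '' S.plaque z = U.plaque ((natExt f)^[n] z)) ∧
    IsDiffeoOn d f^[n] S.base U.base

end Rectangle

end Rectangles

/-! ### Derivatives, exponents and non-degeneracy -/

section Riemannian

variable (d : ℕ) {M : Type*} [MetricSpace M] [ChartedSpace (EuclideanSpace ℝ (Fin d)) M]
  [IsManifold (𝓡 d) ∞ M] [RiemannianBundle (fun x : M => TangentSpace (𝓡 d) x)]

instance (x : M) : FiniteDimensional ℝ (TangentSpace (𝓡 d) x) :=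
  inferInstanceAs (FiniteDimensional ℝ (EuclideanSpace ℝ (Fin d)))

/-- The Jacobian `|det Df(x)|` with respect to the Riemannian metric, written as the square root of
`det (Df(x)* Df(x))`. -/
def riemJacobian (f : M → M) (x : M) : ℝ :=
  Real.sqrt (LinearMap.det
    ((mfderiv (𝓡 d) (𝓡 d) f x).toLinearMap.adjoint ∘ₗ (mfderiv (𝓡 d) (𝓡 d) f x).toLinearMap))

/-- The points at which `f` has no derivative. -/
def singularSet (f : M → M) : Set M := {x | ¬ MDifferentiableAt (𝓡 d) (𝓡 d) f x}

/-- The points at which `f` has a derivative with a nontrivial kernel. -/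
def criticalSet (f : M → M) : Set M :=
  {x | MDifferentiableAt (𝓡 d) (𝓡 d) f x ∧
    ∃ v : TangentSpace (𝓡 d) x, v ≠ 0 ∧ mfderiv (𝓡 d) (𝓡 d) f x v = 0}

/-- A `C²` transformation, possibly with singularities: `f` is `C²` off its singular set. -/
def IsC2Transformation (f : M → M) : Prop :=
  ∀ x, x ∉ singularSet d f → ContMDiffAt (𝓡 d) (𝓡 d) 2 f x

/-- The critical and singular points of `f` are non-degenerate. Each of the first two conditions is
void if there are no points of the kind in question, and the third one compares points `x`, `y`
that are closer to each other than `x` is to the critical and singular points. -/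
def IsNonDegenerate (f : M → M) : Prop :=
  ∃ β A k : ℝ, 0 < β ∧ 0 < A ∧ 0 < k ∧
    ((criticalSet d f).Nonempty → ∃ V : Set M, IsOpen V ∧ criticalSet d f ⊆ V ∧
      BddAbove ((fun x => ‖(mfderiv (𝓡 d) (𝓡 d) f x).inverse‖⁻¹ /
        Metric.infDist x (criticalSet d f) ^ β) '' (V \ (criticalSet d f ∪ singularSet d f))) ∧
      0 < sSup ((fun x => ‖(mfderiv (𝓡 d) (𝓡 d) f x).inverse‖⁻¹ /
        Metric.infDist x (criticalSet d f) ^ β) '' (V \ (criticalSet d f ∪ singularSet d f)))) ∧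
    ((singularSet d f).Nonempty → ∃ W : Set M, IsOpen W ∧ singularSet d f ⊆ W ∧
      BddAbove ((fun x => ‖mfderiv (𝓡 d) (𝓡 d) f x‖ /
        Metric.infDist x (singularSet d f) ^ (-β)) '' (W \ singularSet d f)) ∧
      0 < sSup ((fun x => ‖mfderiv (𝓡 d) (𝓡 d) f x‖ /
        Metric.infDist x (singularSet d f) ^ (-β)) '' (W \ singularSet d f))) ∧
    ∀ x y : M, x ∉ criticalSet d f ∪ singularSet d f → y ∉ criticalSet d f ∪ singularSet d f →
      dist x y ≤ Metric.infDist x (criticalSet d f ∪ singularSet d f) / 2 →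
      |Real.log (riemJacobian d f x) - Real.log (riemJacobian d f y)| ≤
        A * (dist x y / Metric.infDist x (criticalSet d f ∪ singularSet d f) ^ k)

/-- `l` is the Lyapunov exponent of the vector `v` at `x`: `‖Dfⁿ(x) v‖` has exponential growth
rate `l`. -/
def IsLyapunovExponent (f : M → M) (x : M) (v : TangentSpace (𝓡 d) x) (l : ℝ) : Prop :=
  Tendsto (fun n : ℕ => (1 / (n : ℝ)) * Real.log ‖mfderiv (𝓡 d) (𝓡 d) f^[n] x v‖) atTop (𝓝 l)

/-- At almost every point the Lyapunov exponents of all nonzero vectors exist and are positive. -/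
def IsExpandingMeasure [MeasurableSpace M] (f : M → M) (μ : Measure M) : Prop :=
  ∀ᵐ x ∂μ, ∀ v : TangentSpace (𝓡 d) x, v ≠ 0 → ∃ l : ℝ, 0 < l ∧ IsLyapunovExponent d f x v l

/-- `χ` is the least Lyapunov exponent of `μ`. -/
def IsLeastExponent [MeasurableSpace M] (f : M → M) (μ : Measure M) (χ : ℝ) : Prop :=
  ∀ᵐ x ∂μ, IsLeast
    {l : ℝ | ∃ v : TangentSpace (𝓡 d) x, v ≠ 0 ∧ IsLyapunovExponent d f x v l} χ

/-- `max {log ‖Df‖, log ‖Df⁻¹‖}` (a nonnegative function, defined off the critical and singular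
points, which have to be negligible) is integrable. -/
def IsRegularMeasure [MeasurableSpace M] (f : M → M) (μ : Measure M) : Prop :=
  μ (criticalSet d f ∪ singularSet d f) = 0 ∧
    ∫⁻ x, ENNReal.ofReal (max (Real.log ‖mfderiv (𝓡 d) (𝓡 d) f x‖)
      (Real.log ‖(mfderiv (𝓡 d) (𝓡 d) f x).inverse‖)) ∂μ < ⊤

/-- The Riemannian volume of a `d`-dimensional Riemannian manifold, as the `d`-dimensional Hausdorff
measure of the Riemannian distance (the two agree up to a constant factor that depends on `d`
only). -/
def riemVolume (d : ℕ) (M : Type*) [MetricSpace M] [MeasurableSpace M] [BorelSpace M] : Measure M :=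
  Measure.hausdorffMeasure (d : ℝ)

variable {d} in
/-- The rectangle `T` has the property of regular returns, with rate `χ` and constant `C`. -/
structure HasRegularReturns {f : M → M} (T : Rectangle d f) (χ C : ℝ) : Prop where
  nested : ∀ z ∈ T.carrier, ∀ z' ∈ T.carrier, ∀ n m : ℕ, 0 < n → 0 < m →
    DisjointOrNested (backImage f n (T.plaque z)) (backImage f m (T.plaque z'))
  nested_proj : ∀ z ∈ T.carrier, ∀ z' ∈ T.carrier, ∀ n m : ℕ, 0 < n → 0 < m →
    DisjointOrNested (proj f '' backImage f n (T.plaque z))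
      (proj f '' backImage f m (T.plaque z'))
  projIsDiffeo : ∀ z ∈ T.carrier, ∀ n : ℕ, 0 < n →
    ProjIsDiffeo d f (backImage f n (T.plaque z)) (proj f '' backImage f n (T.plaque z))
  isDiffeoOn : ∀ z ∈ T.carrier, ∀ n : ℕ, 0 < n →
    IsDiffeoOn d f^[n] (proj f '' backImage f n (T.plaque z)) T.base
  const_pos : 0 < C
  expansion : ∀ z ∈ T.carrier, ∀ n : ℕ, 0 < n → ∀ w ∈ backImage f n (T.plaque z),
    ∀ v : TangentSpace (𝓡 d) (proj f w),
      C⁻¹ * Real.exp (n * χ / 2) * ‖v‖ ≤ ‖mfderiv (𝓡 d) (𝓡 d) f^[n] (proj f w) v‖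
  forward_distortion : ∀ z ∈ T.carrier, ∀ n : ℕ, 0 < n →
    ∀ w ∈ backImage f n (T.plaque z), ∀ w' ∈ backImage f n (T.plaque z),
      riemJacobian d f^[n] (proj f w) / riemJacobian d f^[n] (proj f w') ≤
        Real.exp (C * dist (f^[n] (proj f w)) (f^[n] (proj f w')))
  backward_distortion : ∀ z ∈ T.carrier, ∀ n : ℕ, 0 < n →
    ∀ w ∈ backImage f n (T.plaque z), ∀ w' ∈ backImage f n (T.plaque z),
      ∃ p : ℝ, Tendsto (fun N : ℕ => ∏ i ∈ Finset.range N,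
          riemJacobian d f (proj f ((natExt f).symm^[i] w)) /
            riemJacobian d f (proj f ((natExt f).symm^[i] w'))) atTop (𝓝 p) ∧
        p ≤ Real.exp (C * dist (proj f w) (proj f w'))

end Riemannian

end

/-! The return map is best read backwards. Once the pull-back by `Fⁿ` of a plaque of `T` is known to
lie in a single plaque whenever it meets `T` (`IsMarkov`), the backward return times depend only on
the height of the plaque. Heights are then sorted by their first backward return time `m` and by the
projection `W` of the pull-back. The plaques over one such class form a `U j`, and their pull-backs
by `Fᵐ` form the matching `S j`.

The Markov property (`backImage_subset_plaque`) is the crux. Nestedness leaves only one bad case: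
the pull-back contains a plaque, so that its projection contains the base. If that projection were
strictly larger, `fⁿ` would map the base into itself but not onto it. By nestedness, at later
returns under `Fⁿ` of a recurrent point, the domains of the inverse branches could then only contain
the first one. Expansion makes their volumes tend to zero, so a neighbourhood of a point of the
support of `μ` would have volume zero, against `μ ≪ Vol` (`branchDomain_subset_base`). Hence the
projection is the base, and the pull-back is the plaque. The same shrinking shows that plaques are
null (`measure_sat_singleton`).

The classes must also be admissible heights. At a fixed time the domains of the inverse branches are
equal or disjoint and open, hence locally constant in the height. By compactness there are finitely
many for each `m`, which is the finiteness claim. The backward return sets are closed, so the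
classes are locally closed. Restricting to the support of the transverse measure removes isolated
points and costs nothing, since plaques are null. `IsPullback.exists_rectangle` builds the
rectangles, and Poincaré recurrence for `F` and for its inverse gives the two statements of full
measure. -/

section

open scoped NNReal ENNReal

/-! ### Derivative bounds and local Lipschitz constants -/

section RiemannianLipschitz

variable {E : Type*} [NormedAddCommGroup E] [NormedSpace ℝ E]
  {H : Type*} [TopologicalSpace H] {I : ModelWithCorners ℝ E H}
  {N : Type*} [PseudoEMetricSpace N] [ChartedSpace H N]
  [RiemannianBundle (fun x : N => TangentSpace I x)]
  {E' : Type*} [NormedAddCommGroup E'] [NormedSpace ℝ E']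
  {H' : Type*} [TopologicalSpace H'] {I' : ModelWithCorners ℝ E' H'}
  {N' : Type*} [PseudoEMetricSpace N'] [ChartedSpace H' N']
  [RiemannianBundle (fun x : N' => TangentSpace I' x)] [IsRiemannianManifold I' N']

/-- A path along which the derivative of `g` is bounded by `K` is mapped to a path which is at most
`K` times as long. -/
theorem edist_map_le_mul_pathELength {g : N → N'} {U : Set N} (hU : IsOpen U)
    (hg : ContMDiffOn I I' 1 g U) {K : ℝ≥0}
    (hK : ∀ y ∈ U, ∀ v : TangentSpace I y, ‖mfderiv I I' g y v‖ₑ ≤ K * ‖v‖ₑ)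
    {γ : ℝ → N} (hγ : ContMDiffOn 𝓘(ℝ, ℝ) I 1 γ (Icc 0 1)) (hγU : MapsTo γ (Icc 0 1) U) :
    edist (g (γ 0)) (g (γ 1)) ≤ K * pathELength I γ 0 1 := by
  rw [IsRiemannianManifold.out (I := I') (g (γ 0)) (g (γ 1))]
  refine (riemannianEDist_le_pathELength (γ := g ∘ γ) (hg.comp hγ hγU) rfl rfl
    zero_le_one).trans ?_
  rw [pathELength_eq_lintegral_mfderiv_Ioo, pathELength_eq_lintegral_mfderiv_Ioo,
    ← lintegral_const_mul' _ _ ENNReal.coe_ne_top]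
  refine setLIntegral_mono' measurableSet_Ioo fun t ht => ?_
  have htI : t ∈ Icc (0 : ℝ) 1 := Ioo_subset_Icc_self ht
  have h1 : MDifferentiableAt 𝓘(ℝ, ℝ) I γ t :=
    (hγ.contMDiffAt (Icc_mem_nhds ht.1 ht.2)).mdifferentiableAt one_ne_zero
  have h2 : MDifferentiableAt I I' g (γ t) :=
    (hg.contMDiffAt (hU.mem_nhds (hγU htI))).mdifferentiableAt one_ne_zero
  rw [mfderiv_comp t h2 h1]
  exact hK _ (hγU htI) _

/-- A map between Riemannian manifolds whose derivative is bounded by `K` is locally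
`K`-Lipschitz. -/
theorem exists_lipschitzOnWith_of_enorm_mfderiv_le [IsRiemannianManifold I N] {g : N → N'} {U : Set N} (hU : IsOpen U)
    (hg : ContMDiffOn I I' 1 g U) {K : ℝ≥0}
    (hK : ∀ y ∈ U, ∀ v : TangentSpace I y, ‖mfderiv I I' g y v‖ₑ ≤ K * ‖v‖ₑ)
    {x : N} (hx : x ∈ U) : ∃ V ∈ 𝓝 x, LipschitzOnWith K g V := by
  obtain ⟨r, hr, hrU⟩ := EMetric.mem_nhds_iff.1 (hU.mem_nhds hx)
  have h3 : 0 < r / 3 := ENNReal.div_pos hr.ne' (by simp)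
  refine ⟨Metric.eball x (r / 3), Metric.eball_mem_nhds x h3, ?_⟩
  intro y hy z hz
  rw [Metric.mem_eball] at hy hz
  have hyz : edist y z < r / 3 + r / 3 := by
    calc edist y z ≤ edist y x + edist z x := edist_triangle_right _ _ _
      _ < r / 3 + r / 3 := ENNReal.add_lt_add hy hz
  -- The bound on `c` keeps every path from `y` of length less than `c` within distance `r` of `x`,
  -- hence in `U`, where the derivative is controlled.
  have main : ∀ c : ℝ≥0∞, edist y z < c → c ≤ r / 3 + r / 3 →
      edist (g y) (g z) ≤ K * c := by
    intro c hc hc'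
    have hc2 := hc
    rw [IsRiemannianManifold.out (I := I) y z] at hc2
    obtain ⟨γ, rfl, rfl, hγ, hlen⟩ := exists_lt_of_riemannianEDist_lt hc2
    have hmaps : MapsTo γ (Icc 0 1) U := by
      intro t ht
      apply hrU
      rw [Metric.mem_eball]
      have h01 : edist (γ t) (γ 0) < c := by
        rw [edist_comm, IsRiemannianManifold.out (I := I) (γ 0) (γ t)]
        refine (riemannianEDist_le_pathELength (hγ.mono (Icc_subset_Icc_right ht.2)) rfl rfl
          ht.1).trans_lt (lt_of_le_of_lt ?_ hlen)
        exact pathELength_mono le_rfl ht.2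
      calc edist (γ t) x ≤ edist (γ t) (γ 0) + edist (γ 0) x := edist_triangle _ _ _
        _ < c + r / 3 := ENNReal.add_lt_add h01 hy
        _ ≤ r / 3 + r / 3 + r / 3 := by gcongr
        _ = r := ENNReal.add_thirds r
    exact (edist_map_le_mul_pathELength hU hg hK hγ hmaps).trans (by gcongr)
  refine ENNReal.le_of_forall_pos_le_add fun ε hε _ => ?_
  have hne : edist y z ≠ ⊤ := hyz.ne_top
  -- Dividing by `K + 1` instead of `K` covers the case `K = 0`.
  have hε' : (0 : ℝ≥0∞) < ε / (K + 1) :=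
    ENNReal.div_pos (by exact_mod_cast hε.ne') (by finiteness)
  have hlt : edist y z < min (edist y z + ε / (K + 1)) (r / 3 + r / 3) :=
    lt_min (ENNReal.lt_add_right hne hε'.ne') hyz
  refine (main _ hlt (min_le_right _ _)).trans ?_
  calc K * min (edist y z + ε / (K + 1)) (r / 3 + r / 3)
      ≤ K * (edist y z + ε / (K + 1)) := by gcongr; exact min_le_left _ _
    _ = K * edist y z + K * (ε / (K + 1)) := mul_add _ _ _
    _ ≤ K * edist y z + (K + 1) * (ε / (K + 1)) := by gcongr; exact le_self_add
    _ = K * edist y z + ε := by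
      rw [ENNReal.mul_div_cancel (by simp) (by finiteness)]

end RiemannianLipschitz

/-! ### Hausdorff measure under locally Lipschitz maps -/

section HausdorffMeasure

/-- A locally `K`-Lipschitz map multiplies the Hausdorff measure by at most `K ^ d`. -/
theorem hausdorffMeasure_image_le_of_locally_lipschitz {X Y : Type*} [EMetricSpace X]
    [SecondCountableTopology X] [MeasurableSpace X] [BorelSpace X] [EMetricSpace Y]
    [MeasurableSpace Y] [BorelSpace Y] {g : X → Y} {U : Set X} (hU : MeasurableSet U) {K : ℝ≥0}
    (hg : ∀ x ∈ U, ∃ V ∈ 𝓝 x, LipschitzOnWith K g V) {s : ℝ} (hs : 0 ≤ s) :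
    Measure.hausdorffMeasure s (g '' U) ≤ (K : ℝ≥0∞) ^ s * Measure.hausdorffMeasure s U := by
  choose! V hV hgV using hg
  obtain ⟨t, htU, htc, hcov⟩ := TopologicalSpace.countable_cover_nhdsWithin
    (s := U) (f := fun x => interior (V x))
    (fun x hx => mem_nhdsWithin_of_mem_nhds (interior_mem_nhds.2 (hV x hx)))
  rcases U.eq_empty_or_nonempty with rfl | hne
  · simp
  have htne : t.Nonempty := by
    obtain ⟨x, hx⟩ := hne
    obtain ⟨i, hi, -⟩ := mem_iUnion₂.1 (hcov hx)
    exact ⟨i, hi⟩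
  obtain ⟨e, he⟩ := htc.exists_eq_range htne
  have hmem : ∀ n, e n ∈ U := fun n => htU (he ▸ mem_range_self n)
  -- Disjoint pieces, each inside one set of the countable cover, so that the Lipschitz bounds add
  -- up without loss.
  let D : ℕ → Set X := fun n => U ∩ disjointed (fun n => interior (V (e n))) n
  have hDm : ∀ n, MeasurableSet (D n) := fun n => hU.inter
    (MeasurableSet.disjointed (fun i => isOpen_interior.measurableSet) n)
  have hDU : ⋃ n, D n = U := by
    rw [← inter_iUnion, iUnion_disjointed, inter_eq_left]
    refine hcov.trans ?_
    rw [he]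
    simp
  have hDd : Pairwise (Function.onFun Disjoint D) := fun i j hij =>
    ((disjoint_disjointed _) hij).mono inter_subset_right inter_subset_right
  calc Measure.hausdorffMeasure s (g '' U)
      = Measure.hausdorffMeasure s (⋃ n, g '' D n) := by rw [← image_iUnion, hDU]
    _ ≤ ∑' n, Measure.hausdorffMeasure s (g '' D n) := measure_iUnion_le _
    _ ≤ ∑' n, (K : ℝ≥0∞) ^ s * Measure.hausdorffMeasure s (D n) := by
      refine ENNReal.tsum_le_tsum fun n => ?_
      refine ((hgV (e n) (hmem n)).mono ?_).hausdorffMeasure_image_le hs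
      exact inter_subset_right.trans ((disjointed_subset _ n).trans interior_subset)
    _ = (K : ℝ≥0∞) ^ s * Measure.hausdorffMeasure s U := by
      rw [ENNReal.tsum_mul_left, ← measure_iUnion hDd hDm, hDU]

/-- In the dimension of the space the Hausdorff measure is a Haar measure; writing `d` as a
`finrank` brings this into play. -/
theorem hausdorffMeasure_ball_lt_top (d : ℕ) (x : EuclideanSpace ℝ (Fin d)) (r : ℝ) :
    Measure.hausdorffMeasure (d : ℝ) (Metric.ball x r) < ⊤ := by
  have h : ((Module.finrank ℝ (EuclideanSpace ℝ (Fin d)) : ℕ) : ℝ) = d := by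
    rw [finrank_euclideanSpace_fin]
  rw [← h]
  exact measure_ball_lt_top

end HausdorffMeasure

/-! ### Riemannian volume: contraction and finiteness -/

section Volume

variable {d : ℕ} {M : Type*} [MetricSpace M] [ChartedSpace (EuclideanSpace ℝ (Fin d)) M]
  [RiemannianBundle (fun x : M => TangentSpace (𝓡 d) x)]

theorem norm_mfderiv_apply_of_eventuallyEq_id {φ : M → M} {y : M} (h : φ =ᶠ[𝓝 y] id)
    (v : TangentSpace (𝓡 d) y) : ‖mfderiv (𝓡 d) (𝓡 d) φ y v‖ = ‖v‖ := by
  have h1 : HasMFDerivAt (𝓡 d) (𝓡 d) φ y (ContinuousLinearMap.id ℝ (TangentSpace (𝓡 d) y)) :=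
    (hasMFDerivAt_id y).congr_of_eventuallyEq h
  -- The norm depends on the base point, and `φ y` equals `y` only propositionally; the equality is
  -- transported here.
  have h2 : ∀ p : M, p = y → ∀ u : EuclideanSpace ℝ (Fin d),
      ‖(show TangentSpace (𝓡 d) p from u)‖ = ‖(show TangentSpace (𝓡 d) y from u)‖ := by
    rintro p rfl u
    rfl
  rw [h1.mfderiv]
  exact h2 _ h.eq_of_nhds v

variable [CompactSpace M] [IsRiemannianManifold (𝓡 d) M] [MeasurableSpace M] [BorelSpace M]

/-- The volume of a set which is mapped diffeomorphically and expandingly onto another set. -/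
theorem riemVolume_le_of_expanding {g : M → M} {W B : Set M} (hg : IsDiffeoOn d g W B) {c : ℝ}
    (hc : 0 < c) (hexp : ∀ x ∈ W, ∀ v : TangentSpace (𝓡 d) x,
      c * ‖v‖ ≤ ‖mfderiv (𝓡 d) (𝓡 d) g x v‖) :
    riemVolume d M W ≤ ENNReal.ofReal c⁻¹ ^ (d : ℝ) * riemVolume d M univ := by
  obtain ⟨hW, hB, hgs, h, hhs, hgm, hhm, hinv⟩ := hg
  -- By the chain rule the derivative of `h` inverts that of `g`, so it contracts by `c⁻¹`.
  have key : ∀ y ∈ B, ∀ v : TangentSpace (𝓡 d) y,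
      ‖mfderiv (𝓡 d) (𝓡 d) h y v‖ₑ ≤ (Real.toNNReal c⁻¹ : ℝ≥0) * ‖v‖ₑ := by
    intro y hy v
    have hh : MDifferentiableAt (𝓡 d) (𝓡 d) h y :=
      (hhs.contMDiffAt (hB.mem_nhds hy)).mdifferentiableAt two_ne_zero
    have hgd : MDifferentiableAt (𝓡 d) (𝓡 d) g (h y) :=
      (hgs.contMDiffAt (hW.mem_nhds (hhm hy))).mdifferentiableAt two_ne_zero
    have hcomp : ‖mfderiv (𝓡 d) (𝓡 d) g (h y) (mfderiv (𝓡 d) (𝓡 d) h y v)‖ = ‖v‖ := by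
      have h1 : mfderiv (𝓡 d) (𝓡 d) g (h y) (mfderiv (𝓡 d) (𝓡 d) h y v) =
          mfderiv (𝓡 d) (𝓡 d) (g ∘ h) y v := by
        rw [mfderiv_comp y hgd hh]
        rfl
      rw [h1]
      refine norm_mfderiv_apply_of_eventuallyEq_id ?_ v
      filter_upwards [hB.mem_nhds hy] with z hz using hinv.2 hz
    have h2 : ‖mfderiv (𝓡 d) (𝓡 d) h y v‖ ≤ c⁻¹ * ‖v‖ := by
      rw [← hcomp, le_inv_mul_iff₀ hc]
      exact hexp (h y) (hhm hy) _
    rw [← ofReal_norm, ← ofReal_norm, ← ENNReal.ofReal, ← ENNReal.ofReal_mul (by positivity)]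
    exact ENNReal.ofReal_le_ofReal h2
  have hloc : ∀ x ∈ B, ∃ V ∈ 𝓝 x, LipschitzOnWith (Real.toNNReal c⁻¹) h V := fun x hx =>
    exists_lipschitzOnWith_of_enorm_mfderiv_le hB (hhs.of_le (by norm_num)) key hx
  have himg : h '' B = W := by
    refine Subset.antisymm hhm.image_subset fun x hx => ⟨g x, hgm hx, hinv.1 hx⟩
  calc riemVolume d M W = riemVolume d M (h '' B) := by rw [himg]
    _ ≤ _ := hausdorffMeasure_image_le_of_locally_lipschitz hB.measurableSet hloc
      (Nat.cast_nonneg d)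
    _ ≤ _ := by
      exact mul_le_mul_right (measure_mono (subset_univ B)) _

variable [IsManifold (𝓡 d) ∞ M]
  [IsContMDiffRiemannianBundle (𝓡 d) ∞ (EuclideanSpace ℝ (Fin d))
    (fun x : M => TangentSpace (𝓡 d) x)]

variable (d M) in
-- Near each point the inverse of a chart is Lipschitz on a Euclidean ball, whose Hausdorff measure
-- is finite; compactness does the rest.
theorem riemVolume_univ_lt_top : riemVolume d M univ < ⊤ := by
  refine isCompact_univ.measure_lt_top_of_nhdsWithin fun x _ => ?_
  rw [nhdsWithin_univ]
  have : IsContinuousRiemannianBundle (EuclideanSpace ℝ (Fin d))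
      (fun x : M => TangentSpace (𝓡 d) x) := by
    obtain ⟨g, hg, hg'⟩ := IsContMDiffRiemannianBundle.exists_contMDiff (IB := 𝓡 d) (n := ∞)
      (F := EuclideanSpace ℝ (Fin d)) (E := fun x : M => TangentSpace (𝓡 d) x)
    exact ⟨g, hg.continuous, hg'⟩
  have : IsManifold (𝓡 d) 1 M := IsManifold.of_le (n := ∞) (by norm_num)
  obtain ⟨K, -, hK⟩ := eventually_enorm_mfderivWithin_symm_extChartAt_lt (𝓡 d) x
  have hr : range (𝓡 d) = univ := by simp
  rw [hr, nhdsWithin_univ] at hK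
  have htgt : (extChartAt (𝓡 d) x).target ∈ 𝓝 (extChartAt (𝓡 d) x x) :=
    extChartAt_target_mem_nhds x
  obtain ⟨U, hUsub, hUo, hxU⟩ := mem_nhds_iff.1 (inter_mem hK htgt)
  have hsm : ContMDiffOn 𝓘(ℝ, EuclideanSpace ℝ (Fin d)) (𝓡 d) 1 (extChartAt (𝓡 d) x).symm U :=
    (contMDiffOn_extChartAt_symm (n := 1) x).mono fun y hy => (hUsub hy).2
  obtain ⟨V, hV, hL⟩ := exists_lipschitzOnWith_of_enorm_mfderiv_le (K := K) hUo hsm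
    (fun y hy v => by
      have h1 := (hUsub hy).1
      rw [mem_ofPred_eq, mfderivWithin_univ] at h1
      rw [enorm_tangentSpace_vectorSpace (v := v)]
      exact (ContinuousLinearMap.le_opENorm (E := EuclideanSpace ℝ (Fin d))
        (mfderiv (𝓡 d) (𝓡 d) (extChartAt (𝓡 d) x).symm y) v).trans
          (mul_le_mul_left h1.le _)) hxU
  obtain ⟨r, hr0, hrV⟩ := Metric.mem_nhds_iff.1 (inter_mem hV (hUo.mem_nhds hxU))
  have hsrc : (extChartAt (𝓡 d) x).source ∈ 𝓝 x :=
    extChartAt_source_mem_nhds (I := 𝓡 d) x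
  refine ⟨(extChartAt (𝓡 d) x).symm '' Metric.ball (extChartAt (𝓡 d) x x) r, ?_, ?_⟩
  · filter_upwards [hsrc, (continuousAt_extChartAt (I := 𝓡 d) x).preimage_mem_nhds
      (Metric.ball_mem_nhds _ hr0)] with y hy1 hy2
    exact ⟨_, hy2, (extChartAt (𝓡 d) x).left_inv hy1⟩
  · refine ((hL.mono fun y hy => (hrV hy).1).hausdorffMeasure_image_le
      (Nat.cast_nonneg d)).trans_lt ?_
    refine ENNReal.mul_lt_top (ENNReal.rpow_lt_top_of_nonneg (Nat.cast_nonneg d)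
      ENNReal.coe_ne_top) ?_
    exact hausdorffMeasure_ball_lt_top d _ r

end Volume

/-! ### The natural extension and the lifted measure -/

section NaturalExtensionBasics

variable {M : Type*} {f : M → M}

theorem natExt_iterate_symm_iterate (n : ℕ) (z : PreOrbit f) :
    (natExt f)^[n] ((natExt f).symm^[n] z) = z :=
  (Function.LeftInverse.iterate (natExt f).right_inv n) z

theorem natExt_symm_iterate_iterate (n : ℕ) (z : PreOrbit f) :
    (natExt f).symm^[n] ((natExt f)^[n] z) = z :=
  (Function.LeftInverse.iterate (natExt f).left_inv n) z

theorem natExt_iterate_injective (n : ℕ) : Function.Injective (natExt f)^[n] :=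
  (natExt f).injective.iterate n

theorem natExt_symm_iterate_apply (n i : ℕ) (z : PreOrbit f) :
    ((natExt f).symm^[n] z).1 i = z.1 (i + n) := by
  induction n generalizing z with
  | zero => rfl
  | succ n ih =>
    rw [Function.iterate_succ_apply, ih]
    rfl

theorem proj_natExt_iterate (n : ℕ) (z : PreOrbit f) :
    proj f ((natExt f)^[n] z) = f^[n] (proj f z) := by
  induction n with
  | zero => rfl
  | succ n ih =>
    rw [Function.iterate_succ_apply', Function.iterate_succ_apply', ← ih]
    rfl

theorem preOrbit_iterate_apply (z : PreOrbit f) (n i : ℕ) : f^[n] (z.1 (i + n)) = z.1 i := by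
  have h := proj_natExt_iterate n ((natExt f).symm^[n] ((natExt f).symm^[i] z))
  rw [natExt_iterate_symm_iterate] at h
  simp only [proj, natExt_symm_iterate_apply] at h
  rw [Nat.add_comm i n]
  simpa using h.symm

theorem natExt_iterate_apply_of_le {n i : ℕ} (h : i ≤ n) (w : PreOrbit f) :
    ((natExt f)^[n] w).1 i = f^[n - i] (proj f w) := by
  have h1 := preOrbit_iterate_apply ((natExt f)^[n] w) (n - i) i
  rw [Nat.add_sub_cancel' h] at h1
  have h2 := natExt_symm_iterate_apply n 0 ((natExt f)^[n] w)
  rw [natExt_symm_iterate_iterate, Nat.zero_add] at h2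
  rw [← h1, ← h2]
  rfl

theorem natExt_iterate_apply_add (n i : ℕ) (w : PreOrbit f) :
    ((natExt f)^[n] w).1 (i + n) = w.1 i := by
  rw [← natExt_symm_iterate_apply, natExt_symm_iterate_iterate]

theorem mem_backImage {n : ℕ} {P : Set (PreOrbit f)} {w : PreOrbit f} :
    w ∈ backImage f n P ↔ (natExt f)^[n] w ∈ P := Iff.rfl

theorem symm_iterate_mem_backImage {n : ℕ} {P : Set (PreOrbit f)} {w : PreOrbit f} :
    (natExt f).symm^[n] w ∈ backImage f n P ↔ w ∈ P := by
  rw [mem_backImage, natExt_iterate_symm_iterate]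

theorem backImage_add (m n : ℕ) (P : Set (PreOrbit f)) :
    backImage f (m + n) P = backImage f m (backImage f n P) := by
  ext w
  rw [mem_backImage, mem_backImage, mem_backImage, add_comm, Function.iterate_add_apply]

theorem natExt_iterate_symm_iterate_of_le {m n : ℕ} (h : m ≤ n) (z : PreOrbit f) :
    (natExt f)^[m] ((natExt f).symm^[n] z) = (natExt f).symm^[n - m] z := by
  conv_lhs => rw [← Nat.add_sub_cancel' h, Function.iterate_add_apply]
  exact natExt_iterate_symm_iterate m _

section Topology

variable [TopologicalSpace M]

theorem continuous_coord (n : ℕ) : Continuous fun z : PreOrbit f => z.1 n :=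
  (continuous_apply n).comp continuous_subtype_val

theorem continuous_proj : Continuous (proj f) := continuous_coord 0

/-- The inverse only shifts coordinates, so nothing is asked of `f`, which may be discontinuous;
continuity of `natExt f` itself is not available in general. -/
theorem continuous_natExt_symm_iterate (n : ℕ) : Continuous (natExt f).symm^[n] := by
  refine Continuous.subtype_mk (f := fun z => ((natExt f).symm^[n] z).1) ?_ _
  refine continuous_pi fun i => ?_
  simp only [natExt_symm_iterate_apply]
  exact continuous_coord _

end Topology

section Measure

variable [MeasurableSpace M]

theorem measurable_coord (n : ℕ) : Measurable fun z : PreOrbit f => z.1 n :=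
  (measurable_pi_apply n).comp measurable_subtype_coe

theorem measurable_natExt (hf : Measurable f) : Measurable (natExt f) := by
  refine Measurable.subtype_mk (f := fun z => ((natExt f) z).1) ?_
  refine measurable_pi_lambda _ fun i => ?_
  cases i with
  | zero => exact hf.comp (measurable_coord 0)
  | succ i => exact measurable_coord i

theorem measurable_natExt_symm : Measurable (natExt f).symm := by
  refine Measurable.subtype_mk (f := fun z => ((natExt f).symm z).1) ?_
  exact measurable_pi_lambda _ fun i => measurable_coord (i + 1)

variable {μ : Measure M} {μbar : Measure (PreOrbit f)}

theorem IsLift.isProbabilityMeasure [IsProbabilityMeasure μ] (h : IsLift f μ μbar) :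
    IsProbabilityMeasure μbar := by
  refine ⟨?_⟩
  have := h 0 univ MeasurableSet.univ
  rwa [preimage_univ, measure_univ (μ := μ)] at this

/-- The lift of an invariant measure is invariant. -/
theorem IsLift.measurePreserving [IsProbabilityMeasure μ] (h : IsLift f μ μbar)
    (hf : MeasurePreserving f μ μ) : MeasurePreserving (natExt f) μbar μbar := by
  have := h.isProbabilityMeasure
  have hF := measurable_natExt hf.measurable
  refine ⟨hF, ?_⟩
  have : IsProbabilityMeasure (μbar.map (natExt f)) :=
    Measure.isProbabilityMeasure_map hF.aemeasurable
  let 𝒞 : Set (Set (PreOrbit f)) :=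
    {s | ∃ (n : ℕ) (A : Set M), MeasurableSet A ∧ s = (fun z : PreOrbit f => z.1 n) ⁻¹' A}
  -- A condition on one coordinate can be read off any later one. This makes `𝒞` a π-system, and
  -- with `k = 1` it gives invariance on `𝒞`.
  have hup : ∀ (n k : ℕ) (A : Set M), (fun z : PreOrbit f => z.1 n) ⁻¹' A =
      (fun z : PreOrbit f => z.1 (n + k)) ⁻¹' (f^[k] ⁻¹' A) := by
    intro n k A
    ext z
    simp only [mem_preimage, preOrbit_iterate_apply]
  refine ext_of_generate_finite 𝒞 ?_ ?_ ?_ (by simp)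
  · refine le_antisymm ?_ (MeasurableSpace.generateFrom_le ?_)
    · rw [Subtype.instMeasurableSpace, MeasurableSpace.pi, MeasurableSpace.comap_iSup]
      refine iSup_le fun n => ?_
      rw [MeasurableSpace.comap_comp]
      rintro s ⟨A, hA, rfl⟩
      exact MeasurableSpace.measurableSet_generateFrom ⟨n, A, hA, rfl⟩
    · rintro s ⟨n, A, hA, rfl⟩
      exact measurable_coord n hA
  · rintro s ⟨n, A, hA, rfl⟩ t ⟨m, A', hA', rfl⟩ -
    refine ⟨n + m, f^[m] ⁻¹' A ∩ f^[n] ⁻¹' A', ?_, ?_⟩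
    · exact (hf.measurable.iterate m hA).inter (hf.measurable.iterate n hA')
    · rw [hup n m A, hup m n A', Nat.add_comm m n]
      rfl
  · rintro s ⟨n, A, hA, rfl⟩
    rw [Measure.map_apply hF (measurable_coord n hA), h n A hA, hup n 1 A]
    exact (h n (f^[1] ⁻¹' A) (hf.measurable.iterate 1 hA)).trans
      (hf.measure_preimage hA.nullMeasurableSet)

theorem IsLift.measurePreserving_symm [IsProbabilityMeasure μ] (h : IsLift f μ μbar)
    (hf : MeasurePreserving f μ μ) : MeasurePreserving (natExt f).symm μbar μbar :=
  MeasurePreserving.symm (e := ⟨natExt f, measurable_natExt hf.measurable, measurable_natExt_symm⟩)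
    (h.measurePreserving hf)

end Measure

end NaturalExtensionBasics

/-! ### Plaques, holonomy and the transverse measure -/

namespace Rectangle

section Plaques

variable {d : ℕ} {M : Type*} [MetricSpace M] [ChartedSpace (EuclideanSpace ℝ (Fin d)) M]
  {f : M → M} (T : Rectangle d f)

/-- The height of a rectangle, as a type. -/
abbrev Height : Type _ := ↥(crossSection f T.carrier T.center)

/-- The holonomy along the plaques to the height. -/
def hol (w : T.carrier) : T.Height := (T.chart w).2

/-- The union of the plaques over a subset of the height. -/
def sat (A : Set T.Height) : Set (PreOrbit f) := {w | ∃ hw : w ∈ T.carrier, T.hol ⟨w, hw⟩ ∈ A}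

/-- The point of the plaque over `k` which projects to `x`. -/
def point (x : T.base) (k : T.Height) : PreOrbit f := (T.chart.symm (x, k)).1

variable {T}

theorem continuous_hol : Continuous T.hol := continuous_snd.comp T.chart.continuous

theorem mem_sat {A : Set T.Height} {w : PreOrbit f} (hw : w ∈ T.carrier) :
    w ∈ T.sat A ↔ T.hol ⟨w, hw⟩ ∈ A := ⟨fun ⟨_, h⟩ => h, fun h => ⟨hw, h⟩⟩

theorem sat_subset (A : Set T.Height) : T.sat A ⊆ T.carrier := fun _ h => h.1

theorem sat_mono {A A' : Set T.Height} (h : A ⊆ A') : T.sat A ⊆ T.sat A' :=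
  fun _ ⟨hw, hA⟩ => ⟨hw, h hA⟩

theorem mem_sat_singleton_hol {w : PreOrbit f} (hw : w ∈ T.carrier) :
    w ∈ T.sat {T.hol ⟨w, hw⟩} := ⟨hw, rfl⟩

theorem hol_eq_of_mem {w : PreOrbit f} {k : T.Height} (h : w ∈ T.sat {k}) :
    T.hol ⟨w, h.1⟩ = k := h.2

theorem plaque_eq {z : PreOrbit f} (hz : z ∈ T.carrier) :
    T.plaque z = T.sat {T.hol ⟨z, hz⟩} := by
  ext w
  exact ⟨fun ⟨hw, _, h⟩ => ⟨hw, h⟩, fun ⟨hw, h⟩ => ⟨hw, hz, h⟩⟩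

theorem plaque_eq_of_mem {z : PreOrbit f} {k : T.Height} (hz : z ∈ T.sat {k}) :
    T.plaque z = T.sat {k} := by
  rw [plaque_eq hz.1, hol_eq_of_mem hz]

theorem hol_height (k : T.Height) : T.hol ⟨k.1, k.2.1⟩ = k := T.chart_snd_center k

theorem height_mem_sat (k : T.Height) : k.1 ∈ T.sat {k} := ⟨k.2.1, hol_height k⟩

theorem plaque_height (k : T.Height) : T.plaque k.1 = T.sat {k} :=
  plaque_eq_of_mem (height_mem_sat k)

theorem point_mem_sat (x : T.base) (k : T.Height) : T.point x k ∈ T.sat {k} :=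
  ⟨(T.chart.symm (x, k)).2, by simp [hol, point]⟩

theorem proj_point (x : T.base) (k : T.Height) : proj f (T.point x k) = x := by
  have := T.chart_fst (T.chart.symm (x, k))
  rw [T.chart.apply_symm_apply] at this
  exact this.symm

theorem proj_mem_base {w : PreOrbit f} (hw : w ∈ T.carrier) : proj f w ∈ T.base := by
  rw [← T.chart_fst ⟨w, hw⟩]
  exact Subtype.coe_prop _

theorem point_proj_hol {w : PreOrbit f} (hw : w ∈ T.carrier) :
    T.point ⟨proj f w, proj_mem_base hw⟩ (T.hol ⟨w, hw⟩) = w := by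
  have : ((⟨proj f w, proj_mem_base hw⟩, T.hol ⟨w, hw⟩) : T.base × T.Height) =
      T.chart ⟨w, hw⟩ := Prod.ext (Subtype.ext (T.chart_fst ⟨w, hw⟩).symm) rfl
  rw [point, this, T.chart.symm_apply_apply]

theorem injOn_proj_sat (k : T.Height) : InjOn (proj f) (T.sat {k}) := by
  intro w hw w' hw' h
  rw [← point_proj_hol hw.1, ← point_proj_hol hw'.1, hol_eq_of_mem hw, hol_eq_of_mem hw']
  congr 1
  exact Subtype.ext h

theorem proj_image_sat (k : T.Height) : proj f '' T.sat {k} = T.base := by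
  ext x
  constructor
  · rintro ⟨w, hw, rfl⟩
    exact proj_mem_base hw.1
  · intro hx
    exact ⟨_, point_mem_sat ⟨x, hx⟩ k, proj_point _ _⟩

theorem continuous_point : Continuous fun p : T.base × T.Height => T.point p.1 p.2 :=
  continuous_subtype_val.comp T.chart.symm.continuous

theorem isOpen_base : IsOpen T.base := by
  obtain ⟨_, _, _, _, h⟩ := T.isOpenDisc_base
  exact h.1

theorem projIsDiffeo_sat (k : T.Height) : ProjIsDiffeo d f (T.sat {k}) T.base :=
  T.projIsDiffeo_plaque k

section Measurable

variable [CompactSpace M]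

theorem secondCountableTopology_height (T : Rectangle d f) : SecondCountableTopology T.Height := by
  have : SecondCountableTopology M := inferInstance
  have : SecondCountableTopology (PreOrbit f) :=
    TopologicalSpace.Subtype.secondCountableTopology _
  exact TopologicalSpace.Subtype.secondCountableTopology _

/-- The chart makes the rectangle a continuous image of base times height, and an open subset of a
compact metric space is σ-compact. Measurability of the rectangle comes from here. -/
theorem isSigmaCompact_carrier (hT : IsCompact T.height) : IsSigmaCompact T.carrier := by
  have h1 : CompactSpace T.Height := isCompact_iff_compactSpace.1 hT
  have h2 : SigmaCompactSpace T.base := by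
    obtain ⟨F, hF, -, hU, -⟩ := IsOpen.exists_iUnion_isClosed (isOpen_base (T := T))
    exact isSigmaCompact_iff_sigmaCompactSpace.1 ⟨F, fun n => (hF n).isCompact, hU⟩
  have h3 : range (fun p : T.base × T.Height => T.point p.1 p.2) = T.carrier := by
    ext w
    constructor
    · rintro ⟨p, rfl⟩
      exact (point_mem_sat p.1 p.2).1
    · intro hw
      exact ⟨(_, _), point_proj_hol hw⟩
  rw [← h3]
  exact isSigmaCompact_range continuous_point

variable [MeasurableSpace M] [BorelSpace M]

theorem measurableSet_carrier (hT : IsCompact T.height) : MeasurableSet T.carrier := by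
  obtain ⟨s, hs, hU⟩ := isSigmaCompact_carrier hT
  rw [← hU]
  exact MeasurableSet.iUnion fun n => (hs n).isClosed.measurableSet

theorem measurableSet_sat (hT : IsCompact T.height) {A : Set T.Height} (hA : MeasurableSet A) :
    MeasurableSet (T.sat A) := by
  have h1 : T.sat A = Subtype.val '' (T.hol ⁻¹' A) := by
    ext w
    exact ⟨fun ⟨hw, h⟩ => ⟨⟨w, hw⟩, h, rfl⟩, fun ⟨u, hu, h⟩ => h ▸ ⟨u.2, hu⟩⟩
  rw [h1]
  exact (MeasurableEmbedding.subtype_coe (measurableSet_carrier hT)).measurableSet_image.2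
    (continuous_hol.measurable hA)

/-- The transverse measure of a rectangle: the measure of a set of heights is the measure of the
union of the plaques over it. -/
noncomputable def transverse (T : Rectangle d f) (μbar : Measure (PreOrbit f)) : Measure T.Height :=
  (μbar.comap (Subtype.val : T.carrier → PreOrbit f)).map T.hol

theorem transverse_apply (hT : IsCompact T.height) (μbar : Measure (PreOrbit f))
    {A : Set T.Height} (hA : MeasurableSet A) : T.transverse μbar A = μbar (T.sat A) := by
  rw [transverse, Measure.map_apply continuous_hol.measurable hA,
    (MeasurableEmbedding.subtype_coe (measurableSet_carrier hT)).comap_apply]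
  congr 1
  ext w
  exact ⟨fun ⟨u, hu, h⟩ => h ▸ ⟨u.2, hu⟩, fun ⟨hw, h⟩ => ⟨⟨w, hw⟩, h, rfl⟩⟩

end Measurable

end Plaques

end Rectangle

/-! ### Positivity of the least exponent and of the dimension -/

section Exponent

variable {d : ℕ} {M : Type*} [MetricSpace M] [ChartedSpace (EuclideanSpace ℝ (Fin d)) M]
  [RiemannianBundle (fun x : M => TangentSpace (𝓡 d) x)] [MeasurableSpace M]
  {f : M → M} {μ : Measure M} [IsProbabilityMeasure μ] {χ : ℝ}

theorem IsLeastExponent.exponent_pos (hexp : IsExpandingMeasure d f μ)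
    (hχ : IsLeastExponent d f μ χ) : 0 < χ := by
  obtain ⟨x, hx1, hx2⟩ := (hexp.and hχ).exists
  obtain ⟨v, hv, hvχ⟩ := hx2.1
  obtain ⟨l, hl, hvl⟩ := hx1 v hv
  rwa [tendsto_nhds_unique hvχ hvl]

/-- The least exponent is attained by a nonzero vector. Positive dimension is what turns expansion
into decay of volumes. -/
theorem IsLeastExponent.dim_pos (hχ : IsLeastExponent d f μ χ) : 0 < d := by
  obtain ⟨x, hx⟩ := Eventually.exists hχ
  obtain ⟨v, hv, -⟩ := hx.1
  rcases Nat.eq_zero_or_pos d with rfl | h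
  · have : Subsingleton (TangentSpace (𝓡 0) x) :=
      inferInstanceAs (Subsingleton (EuclideanSpace ℝ (Fin 0)))
    exact absurd (Subsingleton.elim v 0) hv
  · exact h

end Exponent

/-! ### Domains of inverse branches, the Markov property and null plaques -/

namespace Rectangle

/-- The projection of the pull-back of a plaque by `Fⁿ`. -/
def branchDomain {d : ℕ} {M : Type*} [MetricSpace M] [ChartedSpace (EuclideanSpace ℝ (Fin d)) M]
    {f : M → M} (T : Rectangle d f) (n : ℕ) (k : T.Height) : Set M :=
  proj f '' backImage f n (T.sat {k})

end Rectangle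

namespace HasRegularReturns

open Rectangle

variable {d : ℕ} {M : Type*} [MetricSpace M] [ChartedSpace (EuclideanSpace ℝ (Fin d)) M]
  [RiemannianBundle (fun x : M => TangentSpace (𝓡 d) x)]
  {f : M → M} {T : Rectangle d f} {χ C : ℝ}

theorem nested_sat (hT : HasRegularReturns T χ C) {n m : ℕ} (hn : 0 < n) (hm : 0 < m)
    (k k' : T.Height) :
    DisjointOrNested (backImage f n (T.sat {k})) (backImage f m (T.sat {k'})) := by
  have := hT.nested k.1 k.2.1 k'.1 k'.2.1 n m hn hm
  rwa [plaque_height, plaque_height] at this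

theorem nested_branchDomain (hT : HasRegularReturns T χ C) {n m : ℕ} (hn : 0 < n) (hm : 0 < m)
    (k k' : T.Height) : DisjointOrNested (T.branchDomain n k) (T.branchDomain m k') := by
  have := hT.nested_proj k.1 k.2.1 k'.1 k'.2.1 n m hn hm
  rwa [plaque_height, plaque_height] at this

theorem projIsDiffeo_backImage (hT : HasRegularReturns T χ C) {n : ℕ} (hn : 0 < n)
    (k : T.Height) :
    ProjIsDiffeo d f (backImage f n (T.sat {k})) (T.branchDomain n k) := by
  have := hT.projIsDiffeo k.1 k.2.1 n hn
  rwa [plaque_height] at this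

theorem isDiffeoOn_branchDomain (hT : HasRegularReturns T χ C) {n : ℕ} (hn : 0 < n)
    (k : T.Height) : IsDiffeoOn d f^[n] (T.branchDomain n k) T.base := by
  have := hT.isDiffeoOn k.1 k.2.1 n hn
  rwa [plaque_height] at this

theorem isOpen_branchDomain (hT : HasRegularReturns T χ C) {n : ℕ} (hn : 0 < n)
    (k : T.Height) : IsOpen (T.branchDomain n k) := (hT.isDiffeoOn_branchDomain hn k).1

theorem bijOn_branchDomain (hT : HasRegularReturns T χ C) {n : ℕ} (hn : 0 < n)
    (k : T.Height) : BijOn f^[n] (T.branchDomain n k) T.base := by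
  obtain ⟨-, -, -, h, -, hm, hm', hinv⟩ := hT.isDiffeoOn_branchDomain hn k
  exact hinv.bijOn hm hm'

theorem injOn_proj_backImage (hT : HasRegularReturns T χ C) {n : ℕ} (hn : 0 < n)
    (k : T.Height) : InjOn (proj f) (backImage f n (T.sat {k})) :=
  (hT.projIsDiffeo_backImage hn k).2.1.injOn

/-- Both domains are mapped bijectively onto the same base by the same iterate, so an inclusion
between them is an equality. -/
theorem branchDomain_eq_or_disjoint (hT : HasRegularReturns T χ C) {n : ℕ} (hn : 0 < n)
    (k k' : T.Height) :
    T.branchDomain n k = T.branchDomain n k' ∨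
      Disjoint (T.branchDomain n k) (T.branchDomain n k') := by
  have key : ∀ k k' : T.Height, T.branchDomain n k ⊆ T.branchDomain n k' →
      T.branchDomain n k = T.branchDomain n k' := by
    intro k k' h
    refine Subset.antisymm h fun x hx => ?_
    obtain ⟨y, hy, hxy⟩ := (hT.bijOn_branchDomain hn k).surjOn
      ((hT.bijOn_branchDomain hn k').mapsTo hx)
    rwa [← (hT.bijOn_branchDomain hn k').injOn (h hy) hx hxy]
  rcases hT.nested_branchDomain hn hn k k' with h | h | h
  · exact Or.inr h
  · exact Or.inl (key _ _ h)
  · exact Or.inl (key _ _ h).symm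

theorem expansion_branchDomain (hT : HasRegularReturns T χ C) {n : ℕ} (hn : 0 < n)
    (k : T.Height) : ∀ x ∈ T.branchDomain n k, ∀ v : TangentSpace (𝓡 d) x,
      C⁻¹ * Real.exp (n * χ / 2) * ‖v‖ ≤ ‖mfderiv (𝓡 d) (𝓡 d) f^[n] x v‖ := by
  rintro x ⟨w, hw, rfl⟩ v
  refine hT.expansion k.1 k.2.1 n hn w ?_ v
  rwa [plaque_height]

section Volume

variable [CompactSpace M] [IsManifold (𝓡 d) ∞ M]
  [IsContMDiffRiemannianBundle (𝓡 d) ∞ (EuclideanSpace ℝ (Fin d))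
    (fun x : M => TangentSpace (𝓡 d) x)] [IsRiemannianManifold (𝓡 d) M]
  [MeasurableSpace M] [BorelSpace M]

/-- The volumes of the domains of the inverse branches tend to zero, uniformly. -/
theorem exists_volume_bound (hT : HasRegularReturns T χ C) (hχ : 0 < χ) (hd : 0 < d) :
    ∃ b : ℕ → ℝ≥0∞, Tendsto b atTop (𝓝 0) ∧
      ∀ n, 0 < n → ∀ k, riemVolume d M (T.branchDomain n k) ≤ b n := by
  refine ⟨fun n => ENNReal.ofReal (C⁻¹ * Real.exp (n * χ / 2))⁻¹ ^ (d : ℝ) *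
    riemVolume d M univ, ?_, ?_⟩
  · have h1 : Tendsto (fun n : ℕ => (C⁻¹ * Real.exp (n * χ / 2))⁻¹) atTop (𝓝 0) := by
      refine Tendsto.inv_tendsto_atTop ?_
      refine Tendsto.const_mul_atTop (inv_pos.2 hT.const_pos) (Real.tendsto_exp_atTop.comp ?_)
      exact (tendsto_natCast_atTop_atTop.atTop_mul_const hχ).atTop_div_const two_pos
    have h2 := ENNReal.tendsto_ofReal h1
    rw [ENNReal.ofReal_zero] at h2
    have h3 := (ENNReal.continuous_rpow_const (y := (d : ℝ))).tendsto 0 |>.comp h2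
    rw [ENNReal.zero_rpow_of_pos (by exact_mod_cast hd)] at h3
    have h4 := ENNReal.Tendsto.mul_const (b := riemVolume d M univ) h3
      (Or.inr (riemVolume_univ_lt_top d M).ne)
    rwa [zero_mul] at h4
  · intro n hn k
    exact riemVolume_le_of_expanding (hT.isDiffeoOn_branchDomain hn k)
      (mul_pos (inv_pos.2 hT.const_pos) (Real.exp_pos _)) (hT.expansion_branchDomain hn k)

variable {μ : Measure M} [IsProbabilityMeasure μ] {μbar : Measure (PreOrbit f)}

/-- There is no inverse branch whose domain is larger than the base. -/
theorem branchDomain_subset_base (hT : HasRegularReturns T χ C) (hχ : 0 < χ) (hd : 0 < d)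
    (hf : MeasurePreserving f μ μ) (hac : μ ≪ riemVolume d M) (hlift : IsLift f μ μbar)
    (hcpt : IsCompact T.height) (hpos : 0 < μbar T.carrier) {n : ℕ} (hn : 0 < n) {k : T.Height}
    (hsub : T.base ⊆ T.branchDomain n k) : T.branchDomain n k ⊆ T.base := by
  have := hlift.isProbabilityMeasure
  -- Recurrence is used for the `n`-th iterate, so that the return times are multiples of `n`.
  have hcons : Conservative (natExt f)^[n] μbar :=
    ((hlift.measurePreserving hf).iterate n).conservative
  have hsupp : ∀ᵐ y ∂μbar, proj f y ∈ μ.support := by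
    have h1 : MeasurableSet μ.supportᶜ := Measure.isOpen_compl_support.measurableSet
    have h2 := hlift 0 _ h1
    rw [Measure.measure_compl_support] at h2
    exact h2
  obtain ⟨y, ⟨hy, hyrec⟩, hys⟩ := ((hcons.frequently_ae_mem_and_frequently_image_mem
    (measurableSet_carrier hcpt).nullMeasurableSet hpos.ne').and_eventually hsupp).exists
  obtain ⟨b, hb, hvol⟩ := hT.exists_volume_bound hχ hd
  simp only [← Function.iterate_mul] at hyrec
  -- the branch domain at a return time
  have hreturn : ∀ l, (natExt f)^[n * l] y ∈ T.carrier →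
      ∃ k', proj f y ∈ T.branchDomain (n * l) k' := fun l hl =>
    ⟨_, y, mem_sat_singleton_hol hl, rfl⟩
  obtain ⟨l₁, hl₁, hl₁pos⟩ := (hyrec.and_eventually (eventually_gt_atTop 0)).exists
  obtain ⟨k₁, hk₁⟩ := hreturn l₁ hl₁
  have hp₁ : 0 < n * l₁ := Nat.mul_pos hn hl₁pos
  have hmaps : MapsTo f^[n] T.base T.base := fun x hx =>
    (hT.bijOn_branchDomain hn k).mapsTo (hsub hx)
  by_contra hcon
  -- Otherwise injectivity of `f^[n]` on the branch domain would put every point of that domain in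
  -- the base.
  have hnot : ¬ T.base ⊆ f^[n] '' T.base := by
    intro h
    refine hcon fun v hv => ?_
    obtain ⟨x, hx, hxv⟩ := h ((hT.bijOn_branchDomain hn k).mapsTo hv)
    rwa [← (hT.bijOn_branchDomain hn k).injOn (hsub hx) hv hxv]
  have hlarge : ∃ᶠ l in atTop, riemVolume d M (T.branchDomain (n * l₁) k₁) ≤ b (n * l) := by
    refine (hyrec.and_eventually (eventually_gt_atTop l₁)).mono ?_
    rintro l ⟨hl, hlt⟩
    obtain ⟨k₂, hk₂⟩ := hreturn l hl
    have hp₂ : 0 < n * l := Nat.mul_pos hn (hl₁pos.trans hlt)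
    refine (measure_mono ?_).trans (hvol _ hp₂ k₂)
    rcases hT.nested_branchDomain hp₁ hp₂ k₁ k₂ with h | h | h
    · exact absurd hk₂ (Set.disjoint_left.1 h hk₁)
    · exact h
    -- Were the later domain inside the earlier one, `f^[n * l₁]` would map it into the base. As `l
    -- > l₁`, at least one factor `f^[n]` remains, so the base would lie in `f^[n] '' T.base`.
    · refine absurd ?_ hnot
      intro x hx
      obtain ⟨u, hu, rfl⟩ := (hT.bijOn_branchDomain hp₂ k₂).surjOn hx
      obtain ⟨i, rfl⟩ : ∃ i, l = (1 + i) + l₁ := ⟨l - l₁ - 1, by omega⟩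
      have hmi : MapsTo f^[n * i] T.base T.base := by
        rw [Function.iterate_mul]
        exact hmaps.iterate i
      refine ⟨f^[n * i] (f^[n * l₁] u), hmi ((hT.bijOn_branchDomain hp₁ k₁).mapsTo (h hu)), ?_⟩
      rw [← Function.iterate_add_apply, ← Function.iterate_add_apply]
      congr 2
      ring
  have hzero : riemVolume d M (T.branchDomain (n * l₁) k₁) = 0 := by
    by_contra h0
    have hev : ∀ᶠ l in atTop, b (n * l) < riemVolume d M (T.branchDomain (n * l₁) k₁) :=
      (hb.comp (tendsto_id.const_mul_atTop' hn)).eventually (gt_mem_nhds (pos_iff_ne_zero.2 h0))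
    obtain ⟨l, h1, h2⟩ := (hlarge.and_eventually hev).exists
    exact absurd h1 (not_le.2 h2)
  have hnhds : T.branchDomain (n * l₁) k₁ ∈ 𝓝 (proj f y) :=
    (hT.isOpen_branchDomain hp₁ k₁).mem_nhds hk₁
  exact ((Measure.mem_support_iff_forall _).1 hys _ hnhds).ne' (hac hzero)

/-- If the pull-back of a plaque meets the rectangle, it is contained in a plaque. -/
theorem backImage_subset_plaque (hT : HasRegularReturns T χ C) (hχ : 0 < χ) (hd : 0 < d)
    (hf : MeasurePreserving f μ μ) (hac : μ ≪ riemVolume d M) (hlift : IsLift f μ μbar)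
    (hcpt : IsCompact T.height) (hpos : 0 < μbar T.carrier) {n : ℕ} (hn : 0 < n) {k : T.Height}
    {z : PreOrbit f} (hz : z ∈ T.carrier) (hzk : (natExt f)^[n] z ∈ T.sat {k}) :
    backImage f n (T.sat {k}) ⊆ T.sat {T.hol ⟨z, hz⟩} := by
  set k' := T.hol ⟨z, hz⟩ with hk'
  have hzk' : z ∈ T.sat {k'} := mem_sat_singleton_hol hz
  -- Nestedness is assumed for positive times only, so the plaque and the pull-back are both pulled
  -- back once more before being compared.
  have hback : ∀ (w : PreOrbit f), (natExt f).symm w ∈ backImage f 1 (T.sat {k'}) ↔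
      w ∈ T.sat {k'} := fun w => symm_iterate_mem_backImage (n := 1)
  have hback' : ∀ (w : PreOrbit f), (natExt f).symm w ∈ backImage f (1 + n) (T.sat {k}) ↔
      w ∈ backImage f n (T.sat {k}) := fun w => by
    rw [backImage_add]
    exact symm_iterate_mem_backImage (n := 1)
  rcases hT.nested_sat (Nat.add_pos_left one_pos n) one_pos k k' with h | h | h
  · exact absurd ((hback z).2 hzk') (Set.disjoint_left.1 h ((hback' z).2 hzk))
  · exact fun w hw => (hback w).1 (h ((hback' w).2 hw))
  -- The wrong inclusion forces both sets to have the base as projection; they then agree, as `proj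
  -- f` is injective on the larger one.
  · have hsub : T.sat {k'} ⊆ backImage f n (T.sat {k}) := fun w hw =>
      (hback' w).1 (h ((hback w).2 hw))
    have hbase : T.base ⊆ T.branchDomain n k := by
      rw [← proj_image_sat k']
      exact image_mono hsub
    have hbase' := hT.branchDomain_subset_base hχ hd hf hac hlift hcpt hpos hn hbase
    intro w hw
    have hwb : proj f w ∈ T.base := hbase' ⟨w, hw, rfl⟩
    rw [← proj_image_sat k'] at hwb
    obtain ⟨w', hw', hww'⟩ := hwb
    rwa [← hT.injOn_proj_backImage hn k (hsub hw') hw hww']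

/-- The plaques are negligible. -/
theorem measure_sat_singleton (hT : HasRegularReturns T χ C) (hχ : 0 < χ) (hd : 0 < d)
    (hf : MeasurePreserving f μ μ) (hac : μ ≪ riemVolume d M) (hlift : IsLift f μ μbar)
    (hcpt : IsCompact T.height) (hpos : 0 < μbar T.carrier) (k : T.Height) :
    μbar (T.sat {k}) = 0 := by
  by_contra hne
  have := hlift.isProbabilityMeasure
  have hF := hlift.measurePreserving hf
  have hm : MeasurableSet (T.sat {k}) := measurableSet_sat hcpt (measurableSet_singleton k)
  obtain ⟨n, hn, hn'⟩ := hF.conservative.exists_gt_measure_inter_ne_zero hm.nullMeasurableSet hne 0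
  obtain ⟨z, hz, hzn⟩ := nonempty_of_measure_ne_zero hn'
  -- A plaque of positive measure returns to itself, so its pull-backs by multiples of `n` decrease.
  -- Their measure is constant while their projections shrink to volume zero.
  have hsub : backImage f n (T.sat {k}) ⊆ T.sat {k} := by
    have := hT.backImage_subset_plaque hχ hd hf hac hlift hcpt hpos hn hz.1 hzn
    rwa [hol_eq_of_mem hz] at this
  obtain ⟨b, hb, hvol⟩ := hT.exists_volume_bound hχ hd
  have hanti : Antitone fun l : ℕ => backImage f (n * l) (T.sat {k}) := by
    refine antitone_nat_of_succ_le fun l => ?_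
    rw [Nat.mul_succ, backImage_add]
    exact preimage_mono hsub
  have hmeas : ∀ l : ℕ, MeasurableSet (backImage f (n * l) (T.sat {k})) := fun l =>
    (hF.measurable.iterate _) hm
  have hcst : ∀ l : ℕ, μbar (backImage f (n * l) (T.sat {k})) = μbar (T.sat {k}) := fun l =>
    (hF.iterate _).measure_preimage hm.nullMeasurableSet
  have hlim := tendsto_measure_iInter_atTop (μ := μbar) (fun l => (hmeas l).nullMeasurableSet)
    hanti ⟨0, measure_ne_top _ _⟩
  have hlim' : μbar (⋂ l, backImage f (n * l) (T.sat {k})) = μbar (T.sat {k}) := by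
    refine tendsto_nhds_unique hlim ?_
    simp only [Function.comp_def, hcst]
    exact tendsto_const_nhds
  -- The shift to `l + 1` keeps the times positive, as the facts on branch domains require.
  have hE : ⋂ l, backImage f (n * l) (T.sat {k}) ⊆
      proj f ⁻¹' ⋂ l, T.branchDomain (n * (l + 1)) k := by
    intro w hw
    rw [mem_preimage, mem_iInter]
    exact fun l => ⟨w, mem_iInter.1 hw _, rfl⟩
  have hpos' : ∀ l, 0 < n * (l + 1) := fun l => Nat.mul_pos hn l.succ_pos
  have hvol0 : riemVolume d M (⋂ l, T.branchDomain (n * (l + 1)) k) = 0 := by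
    have htend : Tendsto (fun l => n * (l + 1)) atTop atTop :=
      (tendsto_add_atTop_nat 1).const_mul_atTop' hn
    refine le_antisymm (ge_of_tendsto' (hb.comp htend) fun l => ?_) zero_le
    exact (measure_mono (iInter_subset _ l)).trans (hvol _ (hpos' l) k)
  have hmeas' : MeasurableSet (⋂ l, T.branchDomain (n * (l + 1)) k) :=
    MeasurableSet.iInter fun l => (hT.isOpen_branchDomain (hpos' l) k).measurableSet
  have h0 : μbar (proj f ⁻¹' ⋂ l, T.branchDomain (n * (l + 1)) k) = 0 :=
    (hlift 0 _ hmeas').trans (hac hvol0)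
  exact hne (hlim' ▸ measure_mono_null hE h0)

end Volume

end HasRegularReturns

/-! ### Removing isolated points by means of a measure without atoms -/

section PerfectCore

/-- The points of a locally closed set around which a measure without atoms is positive on the set
form a locally closed set of full measure without isolated points. -/
theorem preperfect_inter_support_restrict {X : Type*} [TopologicalSpace X]
    [SecondCountableTopology X] [T1Space X] [MeasurableSpace X] [BorelSpace X] {ν : Measure X}
    (hν : ∀ x, ν {x} = 0) {D : Set X} (hD : IsLocallyClosed D) :
    IsLocallyClosed (D ∩ (ν.restrict D).support) ∧ Preperfect (D ∩ (ν.restrict D).support) ∧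
      ν (D \ (ν.restrict D).support) = 0 := by
  have hDm : MeasurableSet D := by
    obtain ⟨U, Z, hU, hZ, rfl⟩ := hD
    exact hU.measurableSet.inter hZ.measurableSet
  have hnull : ν (D \ (ν.restrict D).support) = 0 := by
    have h := Measure.measure_compl_support (μ := ν.restrict D)
    rwa [Measure.restrict_apply' hDm, inter_comm, ← Set.sdiff_eq] at h
  refine ⟨hD.inter Measure.isClosed_support.isLocallyClosed, ?_, hnull⟩
  intro x hx
  rw [accPt_iff_nhds]
  intro U hU
  by_contra hcon
  push Not at hcon
  have hpos := (Measure.mem_support_iff_forall x).1 hx.2 U hU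
  rw [Measure.restrict_apply' hDm] at hpos
  -- Around an isolated point the part of `D` would be covered by that point and a null set,
  -- although `x` is in the support.
  refine hpos.ne' (measure_mono_null ?_ (measure_union_null (hν x) hnull))
  rintro y ⟨hyU, hyD⟩
  by_cases hy : y ∈ (ν.restrict D).support
  · exact Or.inl (hcon y ⟨hyU, hyD, hy⟩)
  · exact Or.inr ⟨hyD, hy⟩

theorem Preperfect.image {X Y : Type*} [TopologicalSpace X] [TopologicalSpace Y] {A : Set X}
    (hA : Preperfect A) {φ : X → Y} (hφ : Continuous φ) (hinj : Function.Injective φ) :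
    Preperfect (φ '' A) := by
  rintro _ ⟨x, hx, rfl⟩
  rw [accPt_iff_nhds]
  intro U hU
  obtain ⟨y, ⟨hyU, hyA⟩, hyx⟩ := (accPt_iff_nhds.1 (hA x hx)) _ (hφ.continuousAt hU)
  exact ⟨φ y, ⟨hyU, y, hyA, rfl⟩, fun h => hyx (hinj h)⟩

end PerfectCore

/-! ### Pull-backs of families of plaques are rectangles -/

namespace Rectangle

section Pullback

variable {d : ℕ} {M : Type*} [MetricSpace M] [ChartedSpace (EuclideanSpace ℝ (Fin d)) M]
  {f : M → M}

theorem _root_.IsDiffeoOn.comp {g g' : M → M} {A B B' : Set M} (hg : IsDiffeoOn d g A B)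
    (hg' : IsDiffeoOn d g' B B') : IsDiffeoOn d (g' ∘ g) A B' := by
  obtain ⟨hA, -, hgs, h, hhs, hm, hm', hinv⟩ := hg
  obtain ⟨-, hB', hgs', h', hhs', hn, hn', hinv'⟩ := hg'
  exact ⟨hA, hB', hgs'.comp hgs hm, h ∘ h', hhs.comp hhs' hn', hn.comp hm, hm'.comp hn',
    hinv.comp hinv' hm hn'⟩

/-- The data of a family of plaques of `T`, over a set `D` of heights, whose pull-backs by `Fⁿ`
have the same projection `W`. -/
structure IsPullback (T : Rectangle d f) (n : ℕ) (D : Set T.Height) (W : Set M) : Prop where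
  nonempty : D.Nonempty
  isLocallyClosed : IsLocallyClosed D
  preperfect : Preperfect D
  isDiffeoOn : IsDiffeoOn d f^[n] W T.base
  projIsDiffeo : ∀ k ∈ D, ProjIsDiffeo d f (backImage f n (T.sat {k})) W

namespace IsPullback

variable {T : Rectangle d f} {n : ℕ} {D : Set T.Height} {W : Set M}

theorem bijOn (h : IsPullback T n D W) : BijOn f^[n] W T.base := by
  obtain ⟨-, -, -, g, -, hm, hm', hinv⟩ := h.isDiffeoOn
  exact hinv.bijOn hm hm'

theorem proj_mem (h : IsPullback T n D W) {w : PreOrbit f} (hw : w ∈ backImage f n (T.sat D)) :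
    proj f w ∈ W :=
  (h.projIsDiffeo _ hw.2).2.1.mapsTo (mem_sat_singleton_hol hw.1)

/-- The intermediate iterates are continuous, since they factor through an inverse branch. -/
theorem continuousOn_iterate (h : IsPullback T n D W) {i : ℕ} (hi : i ≤ n) :
    ContinuousOn f^[n - i] W := by
  obtain ⟨k, hk⟩ := h.nonempty
  obtain ⟨-, -, hg⟩ := projIsDiffeo_sat (T := T) k
  obtain ⟨g, hgs, hg⟩ := hg i
  have h1 : ContinuousOn (g ∘ f^[n]) W :=
    hgs.continuousOn.comp h.isDiffeoOn.2.2.1.continuousOn h.bijOn.mapsTo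
  refine h1.congr fun x hx => ?_
  obtain ⟨w, hw, rfl⟩ := (h.projIsDiffeo k hk).2.1.surjOn hx
  rw [Function.comp_apply, ← proj_natExt_iterate n, hg _ hw, natExt_iterate_apply_of_le hi]

/-- The first coordinates of the image are intermediate iterates of the projection, continuous
through inverse branches; the others are coordinates of the point itself. -/
theorem continuousOn_natExt_iterate (h : IsPullback T n D W) :
    ContinuousOn (natExt f)^[n] (backImage f n (T.sat D)) := by
  rw [continuousOn_iff_continuous_domRestrict]
  refine Continuous.subtype_mk
    (f := fun w : backImage f n (T.sat D) => ((natExt f)^[n] w.1).1) ?_ _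
  refine continuous_pi fun i => ?_
  rcases le_total i n with hi | hi
  · simp only [natExt_iterate_apply_of_le hi]
    exact (h.continuousOn_iterate hi).comp_continuous
      (continuous_proj.comp continuous_subtype_val) fun w => h.proj_mem w.2
  · obtain ⟨j, rfl⟩ := Nat.exists_eq_add_of_le' hi
    simp only [natExt_iterate_apply_add]
    exact (continuous_coord j).comp continuous_subtype_val

/-- The union of the pull-backs is a rectangle. -/
theorem exists_rectangle (h : IsPullback T n D W) : ∃ S : Rectangle d f,
    S.carrier = backImage f n (T.sat D) ∧ S.base = W ∧
      ∀ z ∈ S.carrier, S.plaque z = backImage f n (T.plaque ((natExt f)^[n] z)) := by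
  -- Choosing the preimage of the centre of `T` as new centre makes the new height the image of `D`
  -- under the inverse iterate.
  obtain ⟨c, hcW, hc⟩ := h.bijOn.surjOn T.center_mem
  have hF : Continuous fun w : backImage f n (T.sat D) => (natExt f)^[n] w.1 :=
    continuousOn_iff_continuous_domRestrict.1 h.continuousOn_natExt_iterate
  -- the holonomy of the image
  let q : backImage f n (T.sat D) → T.Height := fun w => T.hol ⟨(natExt f)^[n] w.1, w.2.1⟩
  have hq : Continuous q := continuous_hol.comp (hF.subtype_mk _)
  have hqD : ∀ w, q w ∈ D := fun w => w.2.2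
  have hcross : crossSection f (backImage f n (T.sat D)) c =
      (fun k : T.Height => (natExt f).symm^[n] k.1) '' D := by
    ext v
    constructor
    · rintro ⟨hv, hvc⟩
      refine ⟨q ⟨v, hv⟩, hqD _, ?_⟩
      have h1 : (natExt f)^[n] v = (q ⟨v, hv⟩).1 := by
        refine injOn_proj_sat (q ⟨v, hv⟩) (mem_sat_singleton_hol hv.1) (height_mem_sat _) ?_
        rw [proj_natExt_iterate, hvc, hc]
        exact (q ⟨v, hv⟩).2.2.symm
      change (natExt f).symm^[n] (q ⟨v, hv⟩).1 = v
      rw [← h1, natExt_symm_iterate_iterate]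
    · rintro ⟨k, hk, rfl⟩
      have hmem : (natExt f).symm^[n] k.1 ∈ backImage f n (T.sat {k}) :=
        symm_iterate_mem_backImage.2 (height_mem_sat k)
      have hmem' : (natExt f).symm^[n] k.1 ∈ backImage f n (T.sat D) :=
        preimage_mono (sat_mono (singleton_subset_iff.2 hk)) hmem
      refine ⟨hmem', h.bijOn.injOn (h.proj_mem hmem') hcW ?_⟩
      rw [← proj_natExt_iterate, natExt_iterate_symm_iterate, hc]
      exact k.2.2
  have hqcross : ∀ v (hv : v ∈ crossSection f (backImage f n (T.sat D)) c),
      (natExt f).symm^[n] (q ⟨v, hv.1⟩).1 = v := by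
    intro v hv
    have hv' := hv
    rw [hcross] at hv'
    obtain ⟨k, hk, rfl⟩ := hv'
    have h1 : q ⟨(natExt f).symm^[n] k.1, hv.1⟩ = k := by
      have h2 : (natExt f)^[n] ((natExt f).symm^[n] k.1) = k.1 := natExt_iterate_symm_iterate n _
      simp only [q, h2]
      exact hol_height k
    rw [h1]
  have hsymmcross : ∀ k ∈ D, (natExt f).symm^[n] k.1 ∈
      crossSection f (backImage f n (T.sat D)) c := fun k hk => hcross ▸ ⟨k, hk, rfl⟩
  have hback : ∀ (x : T.base) (k : T.Height), k ∈ D →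
      (natExt f).symm^[n] (T.point x k) ∈ backImage f n (T.sat D) := fun x k hk =>
    symm_iterate_mem_backImage.2 (sat_mono (singleton_subset_iff.2 hk) (point_mem_sat x k))
  have hqpoint : ∀ (x : T.base) (k : T.Height) (hk : k ∈ D),
      q ⟨(natExt f).symm^[n] (T.point x k), hback x k hk⟩ = k := by
    intro x k hk
    have h2 : (natExt f)^[n] ((natExt f).symm^[n] (T.point x k)) = T.point x k :=
      natExt_iterate_symm_iterate n _
    simp only [q, h2]
    exact hol_eq_of_mem (point_mem_sat x k)
  let chart : backImage f n (T.sat D) ≃ₜ W × crossSection f (backImage f n (T.sat D)) c :=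
    { toFun := fun w => (⟨proj f w.1, h.proj_mem w.2⟩,
        ⟨(natExt f).symm^[n] (q w).1, hsymmcross _ (hqD w)⟩)
      invFun := fun p => ⟨(natExt f).symm^[n]
        (T.point ⟨f^[n] p.1.1, h.bijOn.mapsTo p.1.2⟩ (q ⟨p.2.1, p.2.2.1⟩)), hback _ _ (hqD _)⟩
      left_inv := by
        rintro ⟨w, hw⟩
        apply Subtype.ext
        have h1 : q ⟨(natExt f).symm^[n] (q ⟨w, hw⟩).1, (hsymmcross _ (hqD ⟨w, hw⟩)).1⟩ =
            q ⟨w, hw⟩ := by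
          have h2 : (natExt f)^[n] ((natExt f).symm^[n] (q ⟨w, hw⟩).1) = (q ⟨w, hw⟩).1 :=
            natExt_iterate_symm_iterate n _
          conv_lhs => simp only [q, h2]
          exact hol_height _
        simp only [h1]
        conv_rhs => rw [← natExt_symm_iterate_iterate n w, ← point_proj_hol hw.1]
        congr 2
        exact Subtype.ext (proj_natExt_iterate n w).symm
      right_inv := by
        rintro ⟨⟨x, hx⟩, ⟨v, hv⟩⟩
        refine Prod.ext (Subtype.ext ?_) (Subtype.ext ?_)
        · refine h.bijOn.injOn (h.proj_mem (hback _ _ (hqD _))) hx ?_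
          rw [← proj_natExt_iterate, natExt_iterate_symm_iterate, proj_point]
        · simp only [hqpoint _ _ (hqD ⟨v, hv.1⟩)]
          exact hqcross v hv
      continuous_toFun := by
        refine Continuous.prodMk ?_ ?_
        · exact (continuous_proj.comp continuous_subtype_val).subtype_mk _
        · exact ((continuous_natExt_symm_iterate n).comp
            (continuous_subtype_val.comp hq)).subtype_mk _
      continuous_invFun := by
        refine Continuous.subtype_mk ((continuous_natExt_symm_iterate n).comp
          (continuous_point.comp (Continuous.prodMk ?_ ?_))) _
        · refine Continuous.subtype_mk ?_ _
          exact (h.isDiffeoOn.2.2.1.continuousOn).comp_continuous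
            (continuous_subtype_val.comp continuous_fst) fun p => p.1.2
        · exact hq.comp ((continuous_subtype_val.comp continuous_snd).subtype_mk _) }
  have hplaque : ∀ v (hv : v ∈ crossSection f (backImage f n (T.sat D)) c),
      {w | ∃ hw : w ∈ backImage f n (T.sat D), (chart ⟨w, hw⟩).2 = ⟨v, hv⟩} =
        backImage f n (T.sat {q ⟨v, hv.1⟩}) := by
    intro v hv
    ext w
    constructor
    · rintro ⟨hw, hwv⟩
      have h1 : (natExt f).symm^[n] (q ⟨w, hw⟩).1 = v := congrArg Subtype.val hwv
      rw [← hqcross v hv] at h1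
      have h2 : q ⟨w, hw⟩ = q ⟨v, hv.1⟩ :=
        Subtype.ext ((natExt f).symm.injective.iterate n h1)
      rw [← h2]
      exact mem_sat_singleton_hol hw.1
    · intro hw
      have hw' : w ∈ backImage f n (T.sat D) :=
        preimage_mono (sat_mono (singleton_subset_iff.2 (hqD _))) hw
      refine ⟨hw', Subtype.ext ?_⟩
      have h1 : q ⟨w, hw'⟩ = q ⟨v, hv.1⟩ := hol_eq_of_mem hw
      change (natExt f).symm^[n] (q ⟨w, hw'⟩).1 = v
      rw [h1, hqcross v hv]
  have hlc : LocallyCompactSpace (crossSection f (backImage f n (T.sat D)) c) := by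
    have h1 : LocallyCompactSpace T.Height := T.locallyCompact_height
    have h2 : LocallyCompactSpace D := h.isLocallyClosed.locallyCompactSpace
    let e : D ≃ₜ crossSection f (backImage f n (T.sat D)) c :=
      { toFun := fun k => ⟨(natExt f).symm^[n] k.1.1, hsymmcross _ k.2⟩
        invFun := fun v => ⟨q ⟨v.1, v.2.1⟩, hqD _⟩
        left_inv := by
          rintro ⟨k, hk⟩
          apply Subtype.ext
          have h2 : (natExt f)^[n] ((natExt f).symm^[n] k.1) = k.1 :=
            natExt_iterate_symm_iterate n _
          simp only [q, h2]
          exact hol_height k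
        right_inv := fun v => Subtype.ext (hqcross v.1 v.2)
        continuous_toFun := ((continuous_natExt_symm_iterate n).comp
          (continuous_subtype_val.comp continuous_subtype_val)).subtype_mk _
        continuous_invFun := (hq.comp (continuous_subtype_val.subtype_mk _)).subtype_mk _ }
    exact e.symm.isClosedEmbedding.locallyCompactSpace
  let S : Rectangle d f :=
    { carrier := backImage f n (T.sat D)
      base := W
      isOpenDisc_base := by
        obtain ⟨x, r, hr, g, hg⟩ := T.isOpenDisc_base
        exact ⟨x, r, hr, _, h.isDiffeoOn.comp hg⟩
      center := c
      center_mem := hcW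
      nonempty_height := by
        rw [hcross]
        exact h.nonempty.image _
      isTotallyDisconnected_height := by
        intro t ht htc
        have h1 : ((natExt f)^[n] '' t).Subsingleton := by
          refine T.isTotallyDisconnected_height _ ?_
            (htc.image _ (h.continuousOn_natExt_iterate.mono fun v hv => (ht hv).1))
          rintro _ ⟨v, hv, rfl⟩
          refine ⟨(ht hv).1.1, ?_⟩
          rw [proj_natExt_iterate, (ht hv).2, hc]
        exact fun v hv v' hv' => natExt_iterate_injective n
          (h1 (mem_image_of_mem _ hv) (mem_image_of_mem _ hv'))
      preperfect_height := by
        rw [hcross]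
        exact h.preperfect.image ((continuous_natExt_symm_iterate n).comp continuous_subtype_val)
          (((natExt f).symm.injective.iterate n).comp Subtype.val_injective)
      locallyCompact_height := hlc
      chart := chart
      chart_fst := fun w => rfl
      chart_snd_center := fun w => Subtype.ext (hqcross w.1 w.2)
      projIsDiffeo_plaque := by
        rintro ⟨v, hv⟩
        rw [hplaque v hv]
        exact h.projIsDiffeo _ (hqD _) }
  refine ⟨S, rfl, rfl, fun z hz => ?_⟩
  have hz' : z ∈ backImage f n (T.sat D) := hz
  have h1 : S.plaque z = {w | ∃ hw : w ∈ backImage f n (T.sat D),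
      (chart ⟨w, hw⟩).2 = ⟨_, hsymmcross _ (hqD ⟨z, hz'⟩)⟩} := by
    ext w
    exact ⟨fun ⟨hw, _, e⟩ => ⟨hw, e⟩, fun ⟨hw, e⟩ => ⟨hw, hz, e⟩⟩
  rw [h1, hplaque]
  have h2 : (natExt f)^[n] ((natExt f).symm^[n] (q ⟨z, hz'⟩).1) = (q ⟨z, hz'⟩).1 :=
    natExt_iterate_symm_iterate n _
  have h3 : q ⟨(natExt f).symm^[n] (q ⟨z, hz'⟩).1, (hsymmcross _ (hqD ⟨z, hz'⟩)).1⟩ =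
      q ⟨z, hz'⟩ := by
    conv_lhs => simp only [q, h2]
    exact hol_height _
  rw [h3, plaque_eq hz'.1]

end IsPullback

end Pullback

end Rectangle

/-! ### First returns and the topology of the sets of heights -/

namespace Rectangle

section Returns

variable {d : ℕ} {M : Type*} [MetricSpace M] [ChartedSpace (EuclideanSpace ℝ (Fin d)) M]
  {f : M → M}

/-- Every pull-back of a plaque which meets `T` is contained in a plaque. -/
def IsMarkov (T : Rectangle d f) : Prop :=
  ∀ n : ℕ, 0 < n → ∀ (k : T.Height) (z : PreOrbit f) (hz : z ∈ T.carrier),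
    (natExt f)^[n] z ∈ T.sat {k} → backImage f n (T.sat {k}) ⊆ T.sat {T.hol ⟨z, hz⟩}

/-- The heights of the plaques whose pull-back by `Fⁿ` is contained in `T`. -/
def returnSet (T : Rectangle d f) (n : ℕ) : Set T.Height :=
  {k | (natExt f).symm^[n] k.1 ∈ T.carrier}

/-- The heights of the plaques with first backward return time `n`. -/
def firstReturnSet (T : Rectangle d f) (n : ℕ) : Set T.Height :=
  {k | k ∈ T.returnSet n ∧ ∀ i, 0 < i → i < n → k ∉ T.returnSet i}

/-- The heights in `firstReturnSet` with a given domain of the inverse branch. -/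
def branchHeights (T : Rectangle d f) (n : ℕ) (W : Set M) : Set T.Height :=
  T.firstReturnSet n ∩ {k | T.branchDomain n k = W}

variable {T : Rectangle d f}

/-- By the Markov property one point of the pull-back in `T` brings the whole pull-back into `T`;
backward returns can therefore be tested at any point of the plaque. -/
theorem symm_iterate_mem_carrier_iff (hM : T.IsMarkov) {n : ℕ} (hn : 0 < n) {k : T.Height}
    {u : PreOrbit f} (hu : u ∈ T.sat {k}) :
    (natExt f).symm^[n] u ∈ T.carrier ↔ k ∈ T.returnSet n := by
  have key : ∀ u ∈ T.sat {k}, ∀ u' ∈ T.sat {k}, (natExt f).symm^[n] u ∈ T.carrier →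
      (natExt f).symm^[n] u' ∈ T.carrier := by
    intro u hu u' hu' h
    refine sat_subset _ (hM n hn k _ h ?_ (symm_iterate_mem_backImage.2 hu'))
    rwa [natExt_iterate_symm_iterate]
  exact ⟨key u hu _ (height_mem_sat k), key _ (height_mem_sat k) u hu⟩

theorem disjoint_firstReturnSet {m n : ℕ} (hm : 0 < m) (hn : 0 < n) (hmn : m ≠ n) :
    Disjoint (T.firstReturnSet m) (T.firstReturnSet n) := by
  rw [Set.disjoint_left]
  intro k hk hk'
  rcases hmn.lt_or_gt with h | h
  · exact hk'.2 m hm h hk.1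
  · exact hk.2 n hn h hk'.1

theorem disjoint_sat {A A' : Set T.Height} (h : Disjoint A A') :
    Disjoint (T.sat A) (T.sat A') := by
  rw [Set.disjoint_left]
  rintro w ⟨_, hw⟩ ⟨_, hw'⟩
  exact Set.disjoint_left.1 h hw hw'

/-- The pull-back of a plaque at its first backward return returns for the first time. -/
theorem firstReturnTime_eq (hM : T.IsMarkov) {m : ℕ} (hm : 0 < m) {w : PreOrbit f}
    (hw : w ∈ backImage f m (T.sat (T.firstReturnSet m))) :
    firstReturnTime f T.carrier w = m := by
  have hmem : m ∈ {n : ℕ | 0 < n ∧ (natExt f)^[n] w ∈ T.carrier} := ⟨hm, hw.1⟩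
  refine le_antisymm (Nat.sInf_le hmem) (le_csInf ⟨m, hmem⟩ ?_)
  rintro i ⟨hi, hiw⟩
  by_contra hlt
  rw [not_le] at hlt
  obtain ⟨hw1, hw2⟩ := hw
  -- A return of `w` at time `i < m` is a backward return of its `m`-th image at the earlier time `m
  -- - i`.
  refine hw2.2 (m - i) (Nat.sub_pos_of_lt hlt) (Nat.sub_lt hm hi) ?_
  rw [← symm_iterate_mem_carrier_iff hM (Nat.sub_pos_of_lt hlt) (mem_sat_singleton_hol hw1)]
  have h1 := natExt_iterate_symm_iterate_of_le hlt.le ((natExt f)^[m] w)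
  rw [natExt_symm_iterate_iterate] at h1
  rwa [← h1]

/-- A point which returns lies in the pull-back of a plaque at its first backward return. -/
theorem exists_mem_backImage_firstReturnSet (hM : T.IsMarkov) {w : PreOrbit f}
    (hw : w ∈ T.carrier) (hret : ∃ n, 0 < n ∧ (natExt f)^[n] w ∈ T.carrier) :
    ∃ m, 0 < m ∧ w ∈ backImage f m (T.sat (T.firstReturnSet m)) := by
  classical
  let m := Nat.find hret
  obtain ⟨hm, hmw⟩ : 0 < m ∧ (natExt f)^[m] w ∈ T.carrier := Nat.find_spec hret
  refine ⟨m, hm, hmw, ?_, ?_⟩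
  · rw [← symm_iterate_mem_carrier_iff hM hm (mem_sat_singleton_hol hmw),
      natExt_symm_iterate_iterate]
    exact hw
  · intro i hi him hcon
    rw [← symm_iterate_mem_carrier_iff hM hi (mem_sat_singleton_hol hmw)] at hcon
    have h1 := natExt_iterate_symm_iterate_of_le (Nat.sub_le m i) ((natExt f)^[m] w)
    rw [natExt_symm_iterate_iterate, Nat.sub_sub_self him.le] at h1
    rw [← h1] at hcon
    exact Nat.find_min hret (Nat.sub_lt hm hi) ⟨Nat.sub_pos_of_lt him, hcon⟩

/-- A point with a backward return lies over the set of heights of a first return. -/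
theorem exists_mem_sat_firstReturnSet (hM : T.IsMarkov) {u : PreOrbit f}
    (hu : u ∈ T.carrier) (hret : ∃ n, 0 < n ∧ (natExt f).symm^[n] u ∈ T.carrier) :
    ∃ m, 0 < m ∧ u ∈ T.sat (T.firstReturnSet m) := by
  classical
  let m := Nat.find hret
  obtain ⟨hm, hmu⟩ : 0 < m ∧ (natExt f).symm^[m] u ∈ T.carrier := Nat.find_spec hret
  refine ⟨m, hm, hu, ?_, ?_⟩
  · rwa [← symm_iterate_mem_carrier_iff hM hm (mem_sat_singleton_hol hu)]
  · intro i hi him hcon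
    rw [← symm_iterate_mem_carrier_iff hM hi (mem_sat_singleton_hol hu)] at hcon
    exact Nat.find_min hret him ⟨hi, hcon⟩

theorem proj_symm_iterate_mem_branchDomain {n : ℕ} (k : T.Height) :
    proj f ((natExt f).symm^[n] k.1) ∈ T.branchDomain n k :=
  ⟨_, symm_iterate_mem_backImage.2 (height_mem_sat k), rfl⟩

variable [RiemannianBundle (fun x : M => TangentSpace (𝓡 d) x)] {χ C : ℝ}

/-- The pulled-back point moves continuously with the height, so it stays in the open domain of `k`;
domains that meet at the same time coincide. -/
theorem _root_.HasRegularReturns.isLocallyConstant_branchDomain (hT : HasRegularReturns T χ C)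
    {n : ℕ} (hn : 0 < n) : IsLocallyConstant (T.branchDomain n) := by
  rw [IsLocallyConstant.iff_eventually_eq]
  intro k
  have hcont : Continuous fun k : T.Height => proj f ((natExt f).symm^[n] k.1) :=
    continuous_proj.comp ((continuous_natExt_symm_iterate n).comp continuous_subtype_val)
  filter_upwards [hcont.continuousAt ((hT.isOpen_branchDomain hn k).mem_nhds
    (proj_symm_iterate_mem_branchDomain k))] with k' hk'
  rcases hT.branchDomain_eq_or_disjoint hn k' k with h | h
  · exact h
  · exact absurd hk' (Set.disjoint_left.1 h (proj_symm_iterate_mem_branchDomain k'))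

/-- The rectangle is not closed, as its base is open. But the projection of the pulled-back height
is locally constant, so only one vertical fibre of `T` matters, and that fibre is compact. -/
theorem _root_.HasRegularReturns.isClosed_returnSet (hT : HasRegularReturns T χ C)
    (hcpt : IsCompact T.height) {n : ℕ} (hn : 0 < n) : IsClosed (T.returnSet n) := by
  have hcs : CompactSpace T.Height := isCompact_iff_compactSpace.1 hcpt
  rw [← isOpen_compl_iff, isOpen_iff_mem_nhds]
  intro k hk
  -- All heights project to the centre, which has a single preimage in the common branch domain.
  have hconst : ∀ᶠ k' in 𝓝 k, proj f ((natExt f).symm^[n] k'.1) =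
      proj f ((natExt f).symm^[n] k.1) := by
    filter_upwards [(IsLocallyConstant.iff_eventually_eq _).1
      (hT.isLocallyConstant_branchDomain hn) k] with k' hk'
    refine (hT.bijOn_branchDomain hn k).injOn
      (hk' ▸ proj_symm_iterate_mem_branchDomain k')
      (proj_symm_iterate_mem_branchDomain k) ?_
    rw [← proj_natExt_iterate, ← proj_natExt_iterate, natExt_iterate_symm_iterate,
      natExt_iterate_symm_iterate]
    exact k'.2.2.trans k.2.2.symm
  by_cases hx : proj f ((natExt f).symm^[n] k.1) ∈ T.base
  · have hclosed : IsClosed (range (T.point ⟨_, hx⟩)) :=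
      (isCompact_range (continuous_point.comp (Continuous.prodMk_right _))).isClosed
    have hcont : Continuous fun k : T.Height => (natExt f).symm^[n] k.1 :=
      (continuous_natExt_symm_iterate n).comp continuous_subtype_val
    have hnot : (natExt f).symm^[n] k.1 ∉ range (T.point ⟨_, hx⟩) := by
      rintro ⟨k', hk'⟩
      refine hk ?_
      change (natExt f).symm^[n] k.1 ∈ T.carrier
      rw [← hk']
      exact (point_mem_sat _ k').1
    filter_upwards [hconst, hcont.continuousAt (hclosed.isOpen_compl.mem_nhds hnot)] with k'
      h1 h2 h3
    refine h2 ⟨T.hol ⟨_, h3⟩, ?_⟩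
    have h4 := point_proj_hol h3
    simp only [h1] at h4
    exact h4
  · filter_upwards [hconst] with k' h1 h2
    exact hx (h1 ▸ proj_mem_base h2)

theorem _root_.HasRegularReturns.isLocallyClosed_branchHeights (hT : HasRegularReturns T χ C)
    (hcpt : IsCompact T.height) {n : ℕ} (hn : 0 < n) (W : Set M) :
    IsLocallyClosed (T.branchHeights n W) := by
  have h1 : T.firstReturnSet n =
      T.returnSet n ∩ ⋂ i ∈ Finset.Ioo 0 n, (T.returnSet i)ᶜ := by
    ext k
    simp [firstReturnSet]
  have h2 : IsOpen (⋂ i ∈ Finset.Ioo 0 n, (T.returnSet i)ᶜ) :=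
    isOpen_biInter_finset fun i hi =>
      (hT.isClosed_returnSet hcpt (Finset.mem_Ioo.1 hi).1).isOpen_compl
  rw [branchHeights, h1]
  exact ((hT.isClosed_returnSet hcpt hn).isLocallyClosed.inter h2.isLocallyClosed).inter
    ((hT.isLocallyConstant_branchDomain hn).isClosed_fiber W).isLocallyClosed

end Returns

/-! ### From a class of heights to a laminated diffeomorphism -/

section Towers

variable {d : ℕ} {M : Type*} [MetricSpace M] [ChartedSpace (EuclideanSpace ℝ (Fin d)) M]
  [RiemannianBundle (fun x : M => TangentSpace (𝓡 d) x)] {f : M → M} {T : Rectangle d f} {χ C : ℝ}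

/-- A set of heights with a common first backward return time and a common inverse branch gives a
subrectangle which is mapped onto a `u`-rectangle by the first return map. -/
theorem _root_.HasRegularReturns.exists_laminatedDiffeo (hT : HasRegularReturns T χ C)
    (hM : T.IsMarkov) {m : ℕ} (hm : 0 < m) {W : Set M} {D : Set T.Height} (hne : D.Nonempty)
    (hlc : IsLocallyClosed D) (hpp : Preperfect D) (hD : D ⊆ T.branchHeights m W) :
    ∃ S U : Rectangle d f, S.carrier = backImage f m (T.sat D) ∧ U.carrier = T.sat D ∧
      S.IsSubrectangle T ∧ U.IsURectangle T ∧ IsLaminatedDiffeo m S U ∧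
      ∀ z ∈ S.carrier, S.carrier ∩ T.plaque z = backImage f m (T.plaque ((natExt f)^[m] z)) := by
  have hW : ∀ k ∈ D, T.branchDomain m k = W := fun k hk => (hD hk).2
  have hpb : IsPullback T m D W :=
    { nonempty := hne
      isLocallyClosed := hlc
      preperfect := hpp
      isDiffeoOn := by
        obtain ⟨k, hk⟩ := hne
        rw [← hW k hk]
        exact hT.isDiffeoOn_branchDomain hm k
      projIsDiffeo := fun k hk => by
        have := hT.projIsDiffeo_backImage hm k
        rwa [hW k hk] at this }
  -- Time zero presents the plaques over `D` themselves as a rectangle.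
  have hpb₀ : IsPullback T 0 D T.base :=
    { nonempty := hne
      isLocallyClosed := hlc
      preperfect := hpp
      isDiffeoOn := ⟨isOpen_base, isOpen_base, contMDiffOn_id, id, contMDiffOn_id,
        mapsTo_id _, mapsTo_id _, fun _ _ => rfl, fun _ _ => rfl⟩
      projIsDiffeo := fun k _ => projIsDiffeo_sat k }
  obtain ⟨S, hSc, hSb, hSp⟩ := hpb.exists_rectangle
  obtain ⟨U, hUc, hUb, hUp⟩ := hpb₀.exists_rectangle
  have hUc' : U.carrier = T.sat D := hUc
  have hUp' : ∀ z ∈ U.carrier, U.plaque z = T.plaque z := hUp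
  have hback : ∀ z (hz : z ∈ backImage f m (T.sat D)),
      ∃ hzT : z ∈ T.carrier, backImage f m (T.plaque ((natExt f)^[m] z)) ⊆
        T.sat {T.hol ⟨z, hzT⟩} := by
    intro z hz
    have hzT : z ∈ T.carrier := by
      have h1 := (symm_iterate_mem_carrier_iff hM hm (mem_sat_singleton_hol hz.1)).2
        (hD hz.2).1.1
      rwa [natExt_symm_iterate_iterate] at h1
    refine ⟨hzT, ?_⟩
    rw [plaque_eq hz.1]
    exact hM m hm _ z hzT (mem_sat_singleton_hol hz.1)
  have hST : S.carrier ⊆ T.carrier := fun z hz => (hback z (hSc ▸ hz)).1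
  have hinter : ∀ z ∈ S.carrier, S.carrier ∩ T.plaque z =
      backImage f m (T.plaque ((natExt f)^[m] z)) := by
    intro z hz
    rw [hSc] at hz ⊢
    obtain ⟨hzT, hsub⟩ := hback z hz
    rw [plaque_eq hzT]
    have hsubD : backImage f m (T.plaque ((natExt f)^[m] z)) ⊆ backImage f m (T.sat D) := by
      rw [plaque_eq hz.1]
      exact preimage_mono (sat_mono (singleton_subset_iff.2 hz.2))
    refine Subset.antisymm ?_ (subset_inter hsubD hsub)
    -- A plaque of `T` holds at most one of the pull-backs: all of them project onto `W`, and `proj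
    -- f` is injective on the plaque. This is why heights are sorted by `W`.
    rintro w ⟨hwD, hwz⟩
    have hw1 : proj f w ∈ T.branchDomain m (T.hol ⟨_, hz.1⟩) := by
      rw [hW _ hz.2]
      exact hpb.proj_mem hwD
    obtain ⟨w', hw', hww'⟩ := hw1
    rw [← plaque_eq hz.1] at hw'
    rwa [← injOn_proj_sat _ (hsub hw') hwz hww']
  refine ⟨S, U, hSc, hUc', ⟨hST, fun z hz => by rw [hSp z hz, hinter z hz]⟩, ⟨⟨?_, ?_⟩, ?_⟩, ?_,
    hinter⟩
  · rw [hUc']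
    exact sat_subset D
  · intro z hz
    rw [hUp' z hz, eq_comm, inter_eq_right, hUc', plaque_eq (sat_subset D (hUc' ▸ hz))]
    exact sat_mono (singleton_subset_iff.2 ((mem_sat _).1 (hUc' ▸ hz)))
  · intro z hz
    rw [inter_eq_right, hUc', plaque_eq (sat_subset D (hUc' ▸ hz))]
    exact sat_mono (singleton_subset_iff.2 ((mem_sat _).1 (hUc' ▸ hz)))
  · refine ⟨?_, ?_, ?_, ?_, ?_⟩
    · rw [hSc, hUc']
      refine ⟨fun w hw => hw, (natExt_iterate_injective m).injOn, fun u hu => ?_⟩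
      exact ⟨_, symm_iterate_mem_backImage.2 hu, natExt_iterate_symm_iterate m u⟩
    · rw [hSc]
      exact hpb.continuousOn_natExt_iterate
    · exact (continuous_natExt_symm_iterate m).continuousOn
    · intro z hz
      have hz' : (natExt f)^[m] z ∈ U.carrier := by
        rw [hSc] at hz
        rw [hUc']
        exact hz
      rw [hSp z hz, hUp' _ hz']
      exact image_preimage_eq _ fun u => ⟨_, natExt_iterate_symm_iterate m u⟩
    · rw [hSb, hUb]
      exact hpb.isDiffeoOn

end Towers

end Rectangle

end

/-! ### Essential heights -/

namespace Rectangle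

variable {d : ℕ} {M : Type*} [MetricSpace M] [CompactSpace M]
  [ChartedSpace (EuclideanSpace ℝ (Fin d)) M] [MeasurableSpace M] [BorelSpace M]
  {f : M → M}

/-- The essential part of `branchHeights` for the transverse measure. -/
def essentialHeights (T : Rectangle d f) (μbar : Measure (PreOrbit f)) (m : ℕ) (W : Set M) :
    Set T.Height :=
  T.branchHeights m W ∩ ((T.transverse μbar).restrict (T.branchHeights m W)).support

variable {T : Rectangle d f} {μbar : Measure (PreOrbit f)}

/-- Almost every point over `firstReturnSet` lies over some set of essential heights. -/
theorem _root_.HasRegularReturns.measure_sat_firstReturnSet_diff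
    [RiemannianBundle (fun x : M => TangentSpace (𝓡 d) x)] {χ C : ℝ}
    (hT : HasRegularReturns T χ C) (hcpt : IsCompact T.height)
    (hatom : ∀ k, μbar (T.sat {k}) = 0) {m : ℕ} (hm : 0 < m) :
    μbar (T.sat (T.firstReturnSet m \ ⋃ W, T.essentialHeights μbar m W)) = 0 := by
  have hcs : CompactSpace T.Height := isCompact_iff_compactSpace.1 hcpt
  have hν : ∀ k, T.transverse μbar {k} = 0 := fun k => by
    rw [transverse_apply hcpt μbar (measurableSet_singleton k), hatom k]
  -- A locally constant map on the compact height has finitely many values.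
  have hfin := (hT.isLocallyConstant_branchDomain hm).range_finite
  have hsub : T.sat (T.firstReturnSet m \ ⋃ W, T.essentialHeights μbar m W) ⊆
      ⋃ W ∈ range (T.branchDomain m), T.sat (T.branchHeights m W \
        ((T.transverse μbar).restrict (T.branchHeights m W)).support) := by
    rintro w ⟨hw, hk, hk'⟩
    refine mem_iUnion₂.2 ⟨_, ⟨T.hol ⟨w, hw⟩, rfl⟩, hw, ⟨hk, rfl⟩, fun hs => hk' ?_⟩
    exact mem_iUnion.2 ⟨_, ⟨hk, rfl⟩, hs⟩
  refine measure_mono_null hsub ((measure_biUnion_null_iff hfin.countable).2 fun W _ => ?_)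
  have hlc := hT.isLocallyClosed_branchHeights hcpt hm W
  have hmeas : MeasurableSet (T.branchHeights m W \
      ((T.transverse μbar).restrict (T.branchHeights m W)).support) := by
    obtain ⟨O, Z, hO, hZ, hOZ⟩ := hlc
    refine MeasurableSet.diff ?_ Measure.isClosed_support.measurableSet
    rw [hOZ]
    exact hO.measurableSet.inter hZ.measurableSet
  have : SecondCountableTopology T.Height := secondCountableTopology_height T
  rw [← transverse_apply hcpt μbar hmeas]
  exact (preperfect_inter_support_restrict hν hlc).2.2

end Rectangle

/-! ### Assembly of the return map -/

open Rectangle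

theorem mainTheorem3
    {d : ℕ} {M : Type*} [MetricSpace M] [CompactSpace M]
    [ChartedSpace (EuclideanSpace ℝ (Fin d)) M] [IsManifold (𝓡 d) ∞ M]
    [RiemannianBundle (fun x : M => TangentSpace (𝓡 d) x)]
    [IsContMDiffRiemannianBundle (𝓡 d) ∞ (EuclideanSpace ℝ (Fin d))
      (fun x : M => TangentSpace (𝓡 d) x)]
    [IsRiemannianManifold (𝓡 d) M]
    [MeasurableSpace M] [BorelSpace M]
    (f : M → M) (hf : IsC2Transformation d f) (hnd : IsNonDegenerate d f)
    (μ : Measure M) [IsProbabilityMeasure μ] (hergodic : Ergodic f μ)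
    (hac : μ ≪ riemVolume d M) (hexp : IsExpandingMeasure d f μ) (hreg : IsRegularMeasure d f μ)
    (χ : ℝ) (hχ : IsLeastExponent d f μ χ)
    (μbar : Measure (PreOrbit f)) (hμbar : IsLift f μ μbar)
    (T : Rectangle d f) (hTcantor : IsCompact T.height)
    (C : ℝ) (hT : HasRegularReturns T χ C) (hpos : 0 < μbar T.carrier) :
    ∃ (J : Type) (_ : Countable J) (S U : J → Rectangle d f) (R : J → ℕ),
      (∀ j, (S j).IsSubrectangle T) ∧ (∀ j, (U j).IsURectangle T) ∧ (∀ j, 0 < R j) ∧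
      Pairwise (fun i j => Disjoint (S i).carrier (S j).carrier) ∧
      Pairwise (fun i j => Disjoint (U i).carrier (U j).carrier) ∧
      μbar (T.carrier \ ⋃ j, (S j).carrier) = 0 ∧
      μbar (T.carrier \ ⋃ j, (U j).carrier) = 0 ∧
      (∀ j, Rectangle.IsLaminatedDiffeo (R j) (S j) (U j)) ∧
      (∀ j, ∀ w ∈ (S j).carrier, firstReturnTime f T.carrier w = R j ∧
        firstReturnMap f T.carrier w = (natExt f)^[R j] w) ∧
      (∀ j, ∀ z ∈ (S j).carrier, ∀ w ∈ (S j).carrier ∩ T.plaque z,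
        ∀ v : TangentSpace (𝓡 d) (proj f w),
          C⁻¹ * Real.exp (R j * χ / 3) * ‖v‖ ≤ ‖mfderiv (𝓡 d) (𝓡 d) f^[R j] (proj f w) v‖) ∧
      (∀ j, ∀ z ∈ (S j).carrier, ∀ w ∈ (S j).carrier ∩ T.plaque z,
        ∀ w' ∈ (S j).carrier ∩ T.plaque z,
          riemJacobian d f^[R j] (proj f w) / riemJacobian d f^[R j] (proj f w') ≤
            Real.exp (C * dist (f^[R j] (proj f w)) (f^[R j] (proj f w')))) ∧
      ∀ m : ℕ, 0 < m → {j | R j = m}.Finite := by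
  have hχpos := hχ.exponent_pos hexp
  have hd := hχ.dim_pos
  have hfμ := hergodic.toMeasurePreserving
  have hprob := hμbar.isProbabilityMeasure
  have hF := hμbar.measurePreserving hfμ
  have hcs : CompactSpace T.Height := isCompact_iff_compactSpace.1 hTcantor
  have : SecondCountableTopology T.Height := secondCountableTopology_height T
  have hM : T.IsMarkov := fun n hn k z hz hzk =>
    hT.backImage_subset_plaque hχpos hd hfμ hac hμbar hTcantor hpos hn hz hzk
  have hatom := hT.measure_sat_singleton hχpos hd hfμ hac hμbar hTcantor hpos
  have hν : ∀ k, T.transverse μbar {k} = 0 := fun k => by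
    rw [transverse_apply hTcantor μbar (measurableSet_singleton k), hatom k]
  let E : ℕ → Set M → Set T.Height := T.essentialHeights μbar
  -- the inverse branches which are used
  let 𝒲 : ℕ → Set (Set M) := fun m => {W | 0 < m ∧ (E m W).Nonempty}
  have hfin : ∀ m, Finite (𝒲 m) := by
    intro m
    refine Set.Finite.to_subtype ?_
    rcases Nat.eq_zero_or_pos m with rfl | hm
    · exact Set.finite_empty.subset fun W hW => absurd hW.1 (lt_irrefl 0)
    · refine (hT.isLocallyConstant_branchDomain hm).range_finite.subset ?_
      rintro W ⟨-, k, hk⟩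
      exact ⟨k, hk.1.2⟩
  -- Numbering the branches keeps the index type in `Type` whatever the universe of `M`; it is
  -- countable, with finite fibres over `m`.
  let J : Type := Σ m : ℕ, Fin (Nat.card (𝒲 m))
  let V : ∀ j : J, 𝒲 j.1 := fun j => (Finite.equivFin (𝒲 j.1)).symm j.2
  have hR : ∀ j : J, 0 < j.1 := fun j => (V j).2.1
  let D : J → Set T.Height := fun j => E j.1 (V j)
  have hDsub : ∀ j, D j ⊆ T.branchHeights j.1 (V j) := fun j => inter_subset_left
  have hDfirst : ∀ j, D j ⊆ T.firstReturnSet j.1 := fun j => (hDsub j).trans inter_subset_left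
  have hcover : ∀ m, 0 < m → ∀ W, ∀ k ∈ E m W, ∃ j : J, j.1 = m ∧ k ∈ D j := by
    intro m hm W k hk
    refine ⟨⟨m, Finite.equivFin (𝒲 m) ⟨W, hm, k, hk⟩⟩, rfl, ?_⟩
    simp only [D, V, Equiv.symm_apply_apply]
    exact hk
  have hDdisj : ∀ i j : J, i ≠ j → Disjoint (D i) (D j) := by
    rintro ⟨m, a⟩ ⟨m', b⟩ hij
    by_cases hmm : m = m'
    · subst hmm
      rw [Set.disjoint_left]
      intro k hk hk'
      refine hij ?_
      have h1 : V ⟨m, a⟩ = V ⟨m, b⟩ :=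
        Subtype.ext ((hDsub ⟨m, a⟩ hk).2.symm.trans (hDsub ⟨m, b⟩ hk').2)
      have h2 : a = b := (Finite.equivFin (𝒲 m)).symm.injective h1
      rw [h2]
    · exact (disjoint_firstReturnSet (hR ⟨m, a⟩) (hR ⟨m', b⟩) hmm).mono (hDfirst _) (hDfirst _)
  have hexists := fun j : J =>
    have hcore := preperfect_inter_support_restrict hν
      (hT.isLocallyClosed_branchHeights hTcantor (hR j) (V j))
    hT.exists_laminatedDiffeo hM (hR j) (V j).2.2 hcore.1 hcore.2.1 (hDsub j)
  choose S U hS hU hSsub hUsub hlam hplaque using hexists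
  have hnull : μbar (⋃ m : {m : ℕ // 0 < m},
      T.sat (T.firstReturnSet m \ ⋃ W, E m W)) = 0 :=
    measure_iUnion_null fun m => hT.measure_sat_firstReturnSet_diff hTcantor hatom m.2
  have hnull' : μbar (⋃ m : {m : ℕ // 0 < m},
      backImage f m (T.sat (T.firstReturnSet m \ ⋃ W, E m W))) = 0 :=
    measure_iUnion_null fun m => (hF.iterate m).quasiMeasurePreserving.preimage_null
      (hT.measure_sat_firstReturnSet_diff hTcantor hatom m.2)
  have hTm : NullMeasurableSet T.carrier μbar := (measurableSet_carrier hTcantor).nullMeasurableSet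
  -- Forward recurrence shows that the `S j` exhaust `T`, and recurrence of the inverse that the `U
  -- j` do.
  have hrec := hF.conservative.ae_mem_imp_frequently_image_mem hTm
  have hrec' :=
    (hμbar.measurePreserving_symm hfμ).conservative.ae_mem_imp_frequently_image_mem hTm
  have hreturn : ∀ j, ∀ w ∈ (S j).carrier, firstReturnTime f T.carrier w = j.1 := by
    intro j w hw
    rw [hS] at hw
    exact firstReturnTime_eq hM (hR j) (preimage_mono (sat_mono (hDfirst j)) hw)
  refine ⟨J, inferInstance, S, U, fun j => j.1, hSsub, hUsub, hR, ?_, ?_, ?_, ?_, hlam, ?_, ?_, ?_,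
    ?_⟩
  · intro i j hij
    rw [Set.disjoint_left]
    intro w hwi hwj
    -- A common point has one first return time, so both sets are pull-backs by the same iterate and
    -- disjointness of the heights applies.
    have h1 : i.1 = j.1 := (hreturn i w hwi).symm.trans (hreturn j w hwj)
    rw [hS] at hwi hwj
    refine Set.disjoint_left.1 (disjoint_sat (hDdisj i j hij)) hwi ?_
    rw [h1]
    exact hwj
  · intro i j hij
    rw [hU, hU]
    exact disjoint_sat (hDdisj i j hij)
  · rw [measure_eq_zero_iff_ae_notMem]
    filter_upwards [hrec, measure_eq_zero_iff_ae_notMem.1 hnull'] with w hw hw'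
    rintro ⟨hwT, hwS⟩
    obtain ⟨n, hn, hn'⟩ := ((hw hwT).and_eventually (eventually_gt_atTop 0)).exists
    obtain ⟨m, hm, hmw, hk⟩ := exists_mem_backImage_firstReturnSet hM hwT ⟨n, hn', hn⟩
    refine hw' (mem_iUnion.2 ⟨⟨m, hm⟩, hmw, hk, fun hE => hwS ?_⟩)
    obtain ⟨W, hW⟩ := mem_iUnion.1 hE
    obtain ⟨j, rfl, hj⟩ := hcover m hm W _ hW
    exact mem_iUnion.2 ⟨j, (hS j).symm ▸ ⟨hmw, hj⟩⟩
  · rw [measure_eq_zero_iff_ae_notMem]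
    filter_upwards [hrec', measure_eq_zero_iff_ae_notMem.1 hnull] with u hu hu'
    rintro ⟨huT, huU⟩
    obtain ⟨n, hn, hn'⟩ := ((hu huT).and_eventually (eventually_gt_atTop 0)).exists
    obtain ⟨m, hm, hmu, hk⟩ := exists_mem_sat_firstReturnSet hM huT ⟨n, hn', hn⟩
    refine hu' (mem_iUnion.2 ⟨⟨m, hm⟩, hmu, hk, fun hE => huU ?_⟩)
    obtain ⟨W, hW⟩ := mem_iUnion.1 hE
    obtain ⟨j, rfl, hj⟩ := hcover m hm W _ hW
    exact mem_iUnion.2 ⟨j, (hU j).symm ▸ ⟨hmu, hj⟩⟩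
  · intro j w hw
    refine ⟨hreturn j w hw, ?_⟩
    rw [firstReturnMap, hreturn j w hw]
  · intro j z hz w hw v
    have hzT : (natExt f)^[j.1] z ∈ T.carrier := by
      rw [hS] at hz
      exact hz.1
    rw [hplaque j z hz] at hw
    refine le_trans ?_ (hT.expansion _ hzT j.1 (hR j) w hw v)
    have hC := hT.const_pos
    -- The rate `χ / 2` of regular returns is stronger than `χ / 3`, as `χ` is positive.
    gcongr
    norm_num
  · intro j z hz w hw w' hw'
    have hzT : (natExt f)^[j.1] z ∈ T.carrier := by
      rw [hS] at hz
      exact hz.1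
    rw [hplaque j z hz] at hw hw'
    exact hT.forward_distortion _ hzT j.1 (hR j) w hw w' hw'
  · intro m _
    refine (Set.finite_range fun a : Fin (Nat.card (𝒲 m)) => (⟨m, a⟩ : J)).subset ?_
    rintro ⟨m', a⟩ rfl
    exact ⟨a, rfl⟩
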